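/- \textbf{Definitions.} Let $G$ be a connected unimodular Lie group with a left-invariant Riemannian metric $g$, let $B_g(x,r)$ be the balls of its Riemannian distance and $\mu_g$ its Riemannian volume (a Haar measure on $G$, whose normalization plays no role below). The \emph{volume doubling constant} of $g$ is $$D_g=\sup_{x\in G,\ r>0}\frac{\mu_g(B_g(x,2r))}{\mu_g(B_g(x,r))}.$$ A family of left-invariant Riemannian metrics on $G$ is \emph{uniformly doubling with constant $D<\infty$} if $D_g\le D$ for every $g$ in the family; the group $G$ is uniformly doubling with constant $D$ if the family of all left-invariant Riemannian metrics on $G$ is. A basis $(u_1,u_2,u_3)$ of $\mathfrak{su}(2)$ is a \emph{standard Milnor basis} if $[u_1,u_2]=u_3$, $[u_2,u_3]=u_1$ and $[u_3,u_1]=u_2$. A left-invariant Riemannian metric $g$ on $\mathrm{SU}(2)\times\mathbb{R}^3$, viewed as an inner product on its Lie algebra $\mathfrak{su}(2)\oplus\mathbb{R}^3$, is \emph{decoupled} if there are a standard Milnor basis $(u_1,u_2,u_3)$ of $\mathfrak{su}(2)$, a $g$-orthonormal basis $(f_1,f_2,f_3)$ of $\mathbb{R}^3$ and a real number $d$ such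 that, with $v_i=u_i+d f_i$, the vectors $v_1,v_2,v_3,f_1,f_2,f_3$ are pairwise $g$-orthogonal. \textbf{Theorem.} Suppose that the family of all decoupled left-invariant Riemannian metrics on $\mathrm{SU}(2)\times\mathbb{R}^3$ is uniformly doubling with constant $D_{\mathrm{dec}}<\infty$. Then for every integer $n\ge 0$ the Lie group $G=\mathrm{SU}(2)\times\mathbb{R}^n$ is uniformly doubling with constant $(2^n D_{\mathrm{dec}})^4$. Moreover, for every closed normal subgroup $S$ of $G$, the quotient Lie group $H=G/S$ is uniformly doubling with the same constant $(2^n D_{\mathrm{dec}})^4$. -/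

import Mathlib

open scoped Manifold ContDiff NNReal ENNReal

noncomputable section

/-- The group `SU(2)` of unitary `2 × 2` complex matrices of determinant one. -/
abbrev SU2 : Type := Matrix.specialUnitaryGroup (Fin 2) ℂ

/-- The unit sphere of `ℝ⁴`. -/
abbrev S3 : Type := Metric.sphere (0 : EuclideanSpace ℝ (Fin 4)) 1

namespace SU2

theorem entries (A : SU2) :
    A.1 1 1 = star (A.1 0 0) ∧ A.1 0 1 = -star (A.1 1 0) := by
  have hA := Matrix.mem_specialUnitaryGroup_iff.1 A.2
  have h1 := Matrix.mem_unitaryGroup_iff'.1 hA.1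
  have hd : A.1 0 0 * A.1 1 1 - A.1 0 1 * A.1 1 0 = 1 := by
    rw [← Matrix.det_fin_two]; exact hA.2
  have e00 := congrFun (congrFun h1 0) 0
  have e01 := congrFun (congrFun h1 0) 1
  simp [Matrix.mul_apply, Fin.sum_univ_two, Matrix.star_apply] at e00 e01
  constructor
  · simp only [Complex.star_def]
    linear_combination (-A.1 1 1) * e00 + A.1 1 0 * e01 + (starRingEnd ℂ) (A.1 0 0) * hd
  · simp only [Complex.star_def]
    linear_combination (-A.1 0 1) * e00 + A.1 0 0 * e01 - (starRingEnd ℂ) (A.1 1 0) * hd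

/-- The real coordinates of the first column of a matrix. -/
def vec (A : Matrix (Fin 2) (Fin 2) ℂ) : EuclideanSpace ℝ (Fin 4) :=
  !₂[(A 0 0).re, (A 0 0).im, (A 1 0).re, (A 1 0).im]

/-- The matrix with columns `(a, b)` and `(-conj b, conj a)`, for `a = x₀ + i x₁`, `b = x₂ + i x₃`. -/
def mat (x : EuclideanSpace ℝ (Fin 4)) : Matrix (Fin 2) (Fin 2) ℂ :=
  !![x 0 + x 1 * Complex.I, -x 2 + x 3 * Complex.I;
    x 2 + x 3 * Complex.I, x 0 - x 1 * Complex.I]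

theorem mem_sphere_iff (x : EuclideanSpace ℝ (Fin 4)) :
    x ∈ Metric.sphere (0 : EuclideanSpace ℝ (Fin 4)) 1 ↔
      x 0 ^ 2 + x 1 ^ 2 + x 2 ^ 2 + x 3 ^ 2 = 1 := by
  rw [mem_sphere_zero_iff_norm, EuclideanSpace.norm_eq, Real.sqrt_eq_one, Fin.sum_univ_four]
  simp

theorem vec_mem (A : SU2) : vec A.1 ∈ Metric.sphere (0 : EuclideanSpace ℝ (Fin 4)) 1 := by
  rw [mem_sphere_iff]
  have h1 := Matrix.mem_unitaryGroup_iff'.1 (Matrix.mem_specialUnitaryGroup_iff.1 A.2).1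
  have e00 := congrArg Complex.re (congrFun (congrFun h1 0) 0)
  simp [Matrix.mul_apply, Fin.sum_univ_two, Matrix.star_apply] at e00
  simp [vec]
  linarith

theorem mat_mem (x : S3) : mat x.1 ∈ Matrix.specialUnitaryGroup (Fin 2) ℂ := by
  have hx := (mem_sphere_iff x.1).1 x.2
  rw [Matrix.mem_specialUnitaryGroup_iff, Matrix.mem_unitaryGroup_iff']
  constructor
  · ext i j
    fin_cases i <;> fin_cases j <;> apply Complex.ext <;>
      simp [mat, Matrix.mul_apply, Fin.sum_univ_two, Matrix.star_apply] <;> linarith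
  · apply Complex.ext <;> simp [mat, Matrix.det_fin_two] <;> linarith

/-- `SU(2)` is homeomorphic to the unit sphere of `ℝ⁴`, through the first column. -/
def toS3 : SU2 ≃ₜ S3 where
  toFun A := ⟨vec A.1, vec_mem A⟩
  invFun x := ⟨mat x.1, mat_mem x⟩
  left_inv A := by
    obtain ⟨h1, h2⟩ := entries A
    apply Subtype.ext
    ext i j
    fin_cases i <;> fin_cases j <;> apply Complex.ext <;> simp [mat, vec, h1, h2]
  right_inv x := by
    apply Subtype.ext
    ext i
    fin_cases i <;> simp [mat, vec]
  continuous_toFun := by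
    refine Continuous.subtype_mk ?_ _
    have h : ∀ i j, Continuous fun A : SU2 => A.1 i j := fun i j =>
      continuous_subtype_val.matrix_elem i j
    refine (PiLp.continuous_toLp 2 _).comp (continuous_pi fun i => ?_)
    fin_cases i
    · exact Complex.continuous_re.comp (h 0 0)
    · exact Complex.continuous_im.comp (h 0 0)
    · exact Complex.continuous_re.comp (h 1 0)
    · exact Complex.continuous_im.comp (h 1 0)
  continuous_invFun := by
    refine Continuous.subtype_mk (continuous_matrix fun i j => ?_) _
    fin_cases i <;> fin_cases j <;> simp [mat] <;> fun_prop

/-- The smooth structure of `SU(2)`: the one of the unit sphere of `ℝ⁴`. -/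
instance : ChartedSpace (EuclideanSpace ℝ (Fin 3)) SU2 where
  atlas := (fun c => toS3.transOpenPartialHomeomorph c) '' atlas (EuclideanSpace ℝ (Fin 3)) S3
  chartAt A := toS3.transOpenPartialHomeomorph (chartAt (EuclideanSpace ℝ (Fin 3)) (toS3 A))
  mem_chart_source A := by simp
  chart_mem_atlas A := ⟨_, chart_mem_atlas _ _, rfl⟩

instance : IsManifold (𝓡 3) ω SU2 where
  compatible := by
    rintro _ _ ⟨c, hc, rfl⟩ ⟨c', hc', rfl⟩
    have h := (contDiffGroupoid ω (𝓡 3)).compatible hc hc'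
    convert h using 1
    ext x <;> simp [OpenPartialHomeomorph.trans]

theorem chartAt_eq (A : SU2) : chartAt (EuclideanSpace ℝ (Fin 3)) A =
    toS3.transOpenPartialHomeomorph (chartAt (EuclideanSpace ℝ (Fin 3)) (toS3 A)) := rfl

theorem finrank_fact : Fact (Module.finrank ℝ (EuclideanSpace ℝ (Fin 4)) = 3 + 1) :=
  ⟨finrank_euclideanSpace_fin⟩

attribute [local instance] finrank_fact

theorem contMDiff_toS3 : ContMDiff (𝓡 3) (𝓡 3) ω toS3 := by
  rw [contMDiff_iff]
  refine ⟨toS3.continuous, fun A x => ?_⟩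
  have h := (contMDiff_iff.1 (contMDiff_id (I := 𝓡 3) (n := ω) (M := S3))).2 (toS3 A) x
  convert h using 1
  · ext y : 1
    simp [extChartAt, chartAt_eq]
  · ext y : 1
    simp [extChartAt, chartAt_eq]

theorem contMDiff_toS3_symm : ContMDiff (𝓡 3) (𝓡 3) ω toS3.symm := by
  rw [contMDiff_iff]
  refine ⟨toS3.symm.continuous, fun x A => ?_⟩
  have h := (contMDiff_iff.1 (contMDiff_id (I := 𝓡 3) (n := ω) (M := S3))).2 x (toS3 A)
  convert h using 1
  · ext y : 1
    simp [extChartAt, chartAt_eq]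
  · ext y : 1
    simp [extChartAt, chartAt_eq]

theorem contMDiff_entry (i j : Fin 2) : ContMDiff (𝓡 3) 𝓘(ℝ, ℂ) ω fun A : SU2 => A.1 i j := by
  have h : ContDiff ℝ ω fun x : EuclideanSpace ℝ (Fin 4) => mat x i j := by
    have hc : ∀ k, ContDiff ℝ ω fun x : EuclideanSpace ℝ (Fin 4) => (x k : ℂ) := fun k =>
      Complex.ofRealCLM.contDiff.comp (by fun_prop)
    fin_cases i <;> fin_cases j <;> simp [mat] <;> fun_prop
  have h2 := (h.contMDiff.comp (contMDiff_coe_sphere (n := 3))).comp contMDiff_toS3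
  convert h2 using 1
  ext A
  exact congrArg (fun B : SU2 => B.1 i j) (toS3.symm_apply_apply A).symm

theorem contMDiff_of_entry {E M : Type*} [NormedAddCommGroup E] [NormedSpace ℝ E]
    {H : Type*} [TopologicalSpace H] {I : ModelWithCorners ℝ E H} [TopologicalSpace M]
    [ChartedSpace H M] [IsManifold I ω M] {f : M → SU2}
    (hf : ∀ i j, ContMDiff I 𝓘(ℝ, ℂ) ω fun x => (f x).1 i j) : ContMDiff I (𝓡 3) ω f := by
  have h : ContMDiff I 𝓘(ℝ, EuclideanSpace ℝ (Fin 4)) ω fun x => vec (f x).1 := by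
    have h0 : ContMDiff I 𝓘(ℝ, Fin 4 → ℝ) ω fun x => (vec (f x).1).ofLp := by
      rw [contMDiff_pi_space]
      intro k
      fin_cases k
      · exact Complex.reCLM.contDiff.contMDiff.comp (hf 0 0)
      · exact Complex.imCLM.contDiff.contMDiff.comp (hf 0 0)
      · exact Complex.reCLM.contDiff.contMDiff.comp (hf 1 0)
      · exact Complex.imCLM.contDiff.contMDiff.comp (hf 1 0)
    exact (EuclideanSpace.equiv (Fin 4) ℝ).symm.contDiff.contMDiff.comp h0
  have h2 := contMDiff_toS3_symm.comp (h.codRestrict_sphere fun x => vec_mem (f x))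
  convert h2 using 1
  ext x : 1
  exact (toS3.symm_apply_apply (f x)).symm

instance : LieGroup (𝓡 3) ω SU2 where
  contMDiff_mul := by
    refine contMDiff_of_entry fun i j => ?_
    have h : ∀ k l, ContMDiff ((𝓡 3).prod (𝓡 3)) 𝓘(ℝ, ℂ) ω fun p : SU2 × SU2 =>
        p.1.1 k l := fun k l => (contMDiff_entry k l).comp contMDiff_fst
    have h' : ∀ k l, ContMDiff ((𝓡 3).prod (𝓡 3)) 𝓘(ℝ, ℂ) ω fun p : SU2 × SU2 =>
        p.2.1 k l := fun k l => (contMDiff_entry k l).comp contMDiff_snd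
    simp only [Submonoid.coe_mul, Matrix.mul_apply, Fin.sum_univ_two]
    have hm : ContDiff ℝ ω fun z : ℂ × ℂ => z.1 * z.2 := contDiff_mul
    exact (hm.contMDiff.comp ((h i 0).prodMk_space (h' 0 j))).add
      (hm.contMDiff.comp ((h i 1).prodMk_space (h' 1 j)))
  contMDiff_inv := by
    refine contMDiff_of_entry fun i j => ?_
    exact Complex.conjCLE.contDiff.contMDiff.comp (contMDiff_entry j i)

end SU2

/-- The vector group `ℝⁿ`, with the vector addition written multiplicatively. -/
abbrev Rvec (n : ℕ) : Type := Multiplicative (EuclideanSpace ℝ (Fin n))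

/-- The smooth structure of `ℝⁿ`, with the identity as its only chart. -/
instance (n : ℕ) : ChartedSpace (EuclideanSpace ℝ (Fin n)) (Rvec n) :=
  inferInstanceAs (ChartedSpace (EuclideanSpace ℝ (Fin n)) (EuclideanSpace ℝ (Fin n)))

instance (n : ℕ) : LieGroup 𝓘(ℝ, EuclideanSpace ℝ (Fin n)) ω (Rvec n) :=
  have h : LieAddGroup 𝓘(ℝ, EuclideanSpace ℝ (Fin n)) ω (EuclideanSpace ℝ (Fin n)) := inferInstance
  { compatible := h.compatible
    contMDiff_mul := h.contMDiff_add
    contMDiff_inv := h.contMDiff_neg }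

/-- The Lie group `SU(2) × ℝⁿ`. -/
abbrev SU2R (n : ℕ) : Type := SU2 × Rvec n

/-- The model with corners of the Lie group `SU(2) × ℝⁿ`. -/
abbrev modelSU2R (n : ℕ) : ModelWithCorners ℝ
    (EuclideanSpace ℝ (Fin 3) × EuclideanSpace ℝ (Fin n))
    (ModelProd (EuclideanSpace ℝ (Fin 3)) (EuclideanSpace ℝ (Fin n))) :=
  (𝓡 3).prod 𝓘(ℝ, EuclideanSpace ℝ (Fin n))

section Metrics

open scoped Bundle

variable {E : Type*} [NormedAddCommGroup E] [NormedSpace ℝ E] {M : Type*} [TopologicalSpace M]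
  (I : ModelWithCorners ℝ E M) (G : Type*) [TopologicalSpace G] [ChartedSpace M G] [Group G]

/-- A left-invariant Riemannian metric on a Lie group: an inner product on every tangent space,
such that every left translation is an isometry. Smoothness in the base point is a consequence of
left invariance, since the group multiplication is smooth. -/
structure LeftInvariantMetric extends
    Bundle.RiemannianMetric (fun x : G => TangentSpace I x) where
  left_invariant : ∀ (a x : G) (v w : TangentSpace I x),
    inner (a * x) (mfderiv I I (fun y => a * y) x v) (mfderiv I I (fun y => a * y) x w) =
      inner x v w

variable {I G}

namespace LeftInvariantMetric

/-- The Riemannian distance of the metric `g`: the infimum of the `g`-lengths of `C¹` paths. -/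
def dist (g : LeftInvariantMetric I G) (x y : G) : ℝ≥0∞ :=
  letI : Bundle.RiemannianBundle (fun x : G => TangentSpace I x) := ⟨g.toRiemannianMetric⟩
  Manifold.riemannianEDist I x y

/-- The ball of centre `x` and radius `r` for the Riemannian distance. -/
def ball (g : LeftInvariantMetric I G) (x : G) (r : ℝ) : Set G :=
  {y | g.dist x y < ENNReal.ofReal r}

/-- The volume doubling constant of the metric measure space `(G, g.dist, μ)`. -/
def doublingConstant (g : LeftInvariantMetric I G) [MeasurableSpace G]
    (μ : MeasureTheory.Measure G) : ℝ≥0∞ :=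
  ⨆ (x : G) (r : ℝ) (_ : 0 < r), μ (g.ball x (2 * r)) / μ (g.ball x r)

end LeftInvariantMetric

/-- A family of left-invariant metrics on `G` is uniformly doubling with the finite constant `D` if
every one of its metrics has volume doubling constant at most `D`. The Riemannian volume of a
left-invariant metric is a left Haar measure, and a positive factor of the measure does not affect
the doubling constant, so that all Haar measures are admitted here. -/
def UniformlyDoubling (L : Set (LeftInvariantMetric I G)) (D : ℝ≥0) : Prop :=
  letI : MeasurableSpace G := borel G
  ∀ g ∈ L, ∀ μ : MeasureTheory.Measure G, μ.IsHaarMeasure → g.doublingConstant μ ≤ D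

end Metrics

section Decoupled

/-- The differential at the identity of the inclusion of `SU(2)` into the complex `2 × 2` matrices;
it identifies the Lie algebra of `SU(2)` with the space of traceless skew-Hermitian matrices, the
Lie bracket being the commutator of matrices. -/
def su2Matrix (u : TangentSpace (𝓡 3) (1 : SU2)) : Matrix (Fin 2) (Fin 2) ℂ :=
  Matrix.of fun i j => mfderiv (𝓡 3) 𝓘(ℝ, ℂ) (fun A : SU2 => A.1 i j) 1 u

/-- A standard Milnor basis of the three-dimensional Lie algebra `su(2)`: a basis such that
`[u₁, u₂] = u₃`, `[u₂, u₃] = u₁` and `[u₃, u₁] = u₂`. -/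
structure IsStandardMilnorBasis (u : Fin 3 → TangentSpace (𝓡 3) (1 : SU2)) : Prop where
  linearIndependent : LinearIndependent ℝ u
  bracket : ∀ i : Fin 3, ⁅su2Matrix (u i), su2Matrix (u (i + 1))⁆ = su2Matrix (u (i + 2))

/-- The element `u + f` of the Lie algebra `su(2) ⊕ ℝⁿ` of `SU(2) × ℝⁿ`. -/
def lieSum {n : ℕ} (u : TangentSpace (𝓡 3) (1 : SU2)) (f : EuclideanSpace ℝ (Fin n)) :
    TangentSpace (modelSU2R n) (1 : SU2R n) :=
  (u, f)

/-- A left-invariant metric `g` on `SU(2) × ℝ³` is decoupled if the Lie algebra has a basis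
`(v₁, v₂, v₃, f₁, f₂, f₃)` of `g`-orthogonal vectors such that `(f₁, f₂, f₃)` is a `g`-orthonormal
basis of `ℝ³` and `vᵢ = uᵢ + d fᵢ` for a real `d` and a standard Milnor basis `(u₁, u₂, u₃)` of
`su(2)`. -/
def IsDecoupled (g : LeftInvariantMetric (modelSU2R 3) (SU2R 3)) : Prop :=
  ∃ (u : Fin 3 → TangentSpace (𝓡 3) (1 : SU2)) (f : Fin 3 → EuclideanSpace ℝ (Fin 3)) (d : ℝ),
    IsStandardMilnorBasis u ∧
    (∀ i j, g.inner 1 (lieSum 0 (f i)) (lieSum 0 (f j)) = if i = j then 1 else 0) ∧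
    (∀ i j, i ≠ j → g.inner 1 (lieSum (u i) (d • f i)) (lieSum (u j) (d • f j)) = 0) ∧
    (∀ i j, g.inner 1 (lieSum (u i) (d • f i)) (lieSum 0 (f j)) = 0)

end Decoupled

section Quotient

variable {E : Type*} [NormedAddCommGroup E] [NormedSpace ℝ E] {M : Type*} [TopologicalSpace M]
  (I : ModelWithCorners ℝ E M) {G : Type*} [TopologicalSpace G] [ChartedSpace M G] [Group G]
  {E' : Type*} [NormedAddCommGroup E'] [NormedSpace ℝ E'] {M' : Type*} [TopologicalSpace M']
  (I' : ModelWithCorners ℝ E' M') {H : Type*} [TopologicalSpace H] [ChartedSpace M' H] [Group H]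

/-- The homomorphism `φ : G → H` of Lie groups exhibits `H` as the quotient Lie group `G / S`: it
is a surjective smooth submersion with kernel `S`. -/
structure IsLieQuotientMap (S : Subgroup G) (φ : G →* H) : Prop where
  contMDiff : ContMDiff I I' ∞ φ
  submersion : ∀ x, Function.Surjective (mfderiv I I' φ x)
  surjective : Function.Surjective φ
  ker_eq : φ.ker = S

end Quotient

end

/-! Let `φ` map SU(2) × ℝⁿ onto H by a submersion with differential `L` at the identity, and let g
be a left-invariant metric on H. Up to bounded distortion, (H, g) is a quotient of P = (SU(2) × ℝ³)
× ℝⁿ, where the first factor carries a decoupled metric and the second the Euclidean one. Doubling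
holds on P with constant 2ⁿD and descends to H at the cost of a fourth power.

The presentation is linear algebra (`exists_decoupled_presentation`). Pull g back along `L` and
complete it on ker `L` to an inner product on su(2) ⊕ ℝⁿ. The orthogonal complement of ℝⁿ is the
graph of a linear map, so it is spanned by vectors uᵢ + Tuᵢ, and the spectral theorem makes these
orthogonal for some standard Milnor basis. The vectors Tuᵢ may be dependent and in any position.
Replace them by d fᵢ, with fᵢ orthonormal in an auxiliary ℝ³, and send d fᵢ to Tuᵢ. This defines `A`
: ℝ³ → ℝⁿ, which is a contraction once d is large. The map Ψ((a, t), y) = φ(a, At + By), with `B` an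
isometric parametrization of ℝⁿ, is then a homomorphism that is 1-Lipschitz on each factor, so
product balls of radius r land in balls of radius 2r.

Conversely, a ball of radius r in H lifts to the product ball of radius 3r
(`exists_lift_of_mem_ball`). Near the identity, a product of three one-parameter subgroups gives a
lift of size at most 2 times the Euclidean norm, since √3 ≤ 2, and `le_mul_dist_of_subadditive`
propagates this along paths with an arbitrarily small multiplicative loss, here 3/2.

Finally `measure_le_of_quotient_ball` integrates over the fibres of Ψ by Weil's formula. It compares
balls of P of radii 8r and r/2, whose ratio 2⁴ accounts for the exponent 4. -/

noncomputable section

/-! ### Haar measure and doubling under a quotient homomorphism. -/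

section QuotientMeasure

open MeasureTheory Measure Set Topology
open scoped Pointwise

variable {P H : Type*} [Group P] [TopologicalSpace P] [IsTopologicalGroup P] [PolishSpace P]
  [LocallyCompactSpace P] [MeasurableSpace P] [BorelSpace P]
  [Group H] [TopologicalSpace H] [IsTopologicalGroup H] [T2Space H]
  [SecondCountableTopology H] [MeasurableSpace H] [BorelSpace H]

/-- Weil's formula for a quotient homomorphism: integrating the Haar measures of the fibres gives
a multiple of the Haar measure. -/
theorem exists_fiber_haar_lintegral (Φ : P →* H) (hc : Continuous Φ) (hs : Function.Surjective Φ)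
    (μH : Measure H) [μH.IsHaarMeasure] (μP : Measure P) [μP.IsHaarMeasure] :
    ∃ (c : ℝ≥0) (ν : Measure Φ.ker), ν.IsHaarMeasure ∧ ∀ A : Set P, MeasurableSet A →
      ∃ f : H → ℝ≥0∞, Measurable f ∧ (∀ p, f (Φ p) = ν {s | p * s ∈ A}) ∧
        ∫⁻ h, f h ∂μH = c * μP A := by
  have hclosed : IsClosed (Φ.ker : Set P) := by
    have : (Φ.ker : Set P) = Φ ⁻¹' {1} := by ext x; simp [MonoidHom.mem_ker]
    rw [this]
    exact isClosed_singleton.preimage hc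
  have : LocallyCompactSpace Φ.ker := hclosed.isClosedEmbedding_subtypeVal.locallyCompactSpace
  obtain ⟨ν, hν⟩ : ∃ ν : Measure Φ.ker, ν.IsHaarMeasure := ⟨haar, inferInstance⟩
  have : SecondCountableTopology Φ.ker := IsEmbedding.subtypeVal.secondCountableTopology
  have : SigmaCompactSpace Φ.ker := sigmaCompactSpace_of_locallyCompact_secondCountable
  have : SigmaFinite ν := IsHaarMeasure.sigmaFinite ν
  let σ := Function.surjInv hs
  have hσ : ∀ h, Φ (σ h) = h := Function.surjInv_eq hs
  let κ : H → Measure P := fun h => ν.map fun s : Φ.ker => σ h * (s : P)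
  have hmeas : ∀ p : P, Measurable fun s : Φ.ker => p * (s : P) := fun p =>
    (continuous_const.mul continuous_subtype_val).measurable
  have hκ0 : ∀ (h : H) {A : Set P}, MeasurableSet A → κ h A = ν {s | σ h * s ∈ A} :=
    fun h A hA => map_apply (hmeas _) hA
  -- Left invariance of `ν` makes the fibre measure independent of the chosen, possibly
  -- non-measurable, section `σ`.
  have hκ : ∀ (p : P) {A : Set P}, MeasurableSet A → κ (Φ p) A = ν {s | p * s ∈ A} := by
    intro p A hA
    rw [hκ0 _ hA]
    have hk : p⁻¹ * σ (Φ p) ∈ Φ.ker := by simp [MonoidHom.mem_ker, hσ]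
    rw [← measure_preimage_mul ν ⟨_, hk⟩ {s | p * (s : P) ∈ A}]
    congr 1
    ext s
    simp [← mul_assoc]
  have hκm : Measurable κ := by
    refine measurable_of_measurable_coe _ fun A hA => ?_
    intro t ht
    -- Since P is Polish, measurability on H may be tested after composing with the surjection `Φ`;
    -- upstairs it is the measurability of sections of a measurable set.
    rw [← hc.measurable.measurableSet_preimage_iff_of_surjective hs, ← preimage_comp]
    have h2 : (fun h => κ h A) ∘ Φ =
        fun p => ν (Prod.mk p ⁻¹' {q : P × Φ.ker | q.1 * q.2 ∈ A}) := by
      ext p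
      exact hκ p hA
    rw [h2]
    refine measurable_measure_prodMk_left ?_ ht
    exact (continuous_fst.mul (continuous_subtype_val.comp continuous_snd)).measurable hA
  let lam := μH.bind κ
  have hlam : ∀ {A : Set P}, MeasurableSet A → lam A = ∫⁻ h, κ h A ∂μH := fun hA =>
    bind_apply hA hκm.aemeasurable
  have hinv : lam.IsMulLeftInvariant := by
    refine ⟨fun q => ?_⟩
    ext A hA
    have hq : MeasurableSet ((fun x => q * x) ⁻¹' A) := (measurable_const_mul q) hA
    rw [map_apply (measurable_const_mul q) hA, hlam hq, hlam hA,
      ← lintegral_mul_left_eq_self (fun h => κ h A) (Φ q)]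
    refine lintegral_congr fun h => ?_
    obtain ⟨p, rfl⟩ := hs h
    rw [hκ p hq, ← map_mul, hκ (q * p) hA]
    simp [mul_assoc]
  have hfin : IsFiniteMeasureOnCompacts lam := by
    refine ⟨fun K hK => ?_⟩
    rw [hlam hK.measurableSet]
    have hK2 : IsCompact ((↑) ⁻¹' (K⁻¹ * K) : Set Φ.ker) :=
      hclosed.isClosedEmbedding_subtypeVal.isCompact_preimage (hK.inv.mul hK)
    -- The fibre measure of K vanishes off the compact set `Φ '' K`. On it, translating by a point
    -- of K puts the fibre inside the compact set ker Φ ∩ K⁻¹K.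
    calc ∫⁻ h, κ h K ∂μH
        ≤ ∫⁻ h, (Φ '' K).indicator (fun _ => ν ((↑) ⁻¹' (K⁻¹ * K))) h ∂μH := by
          refine lintegral_mono fun h => ?_
          by_cases hh : h ∈ Φ '' K
          · rw [indicator_of_mem hh]
            obtain ⟨p, hp, rfl⟩ := hh
            change κ (Φ p) K ≤ _
            rw [hκ p hK.measurableSet]
            refine measure_mono fun s hs => ?_
            exact ⟨p⁻¹, inv_mem_inv.2 hp, p * s, hs, by simp⟩
          · rw [indicator_of_notMem hh]
            change κ h K ≤ _
            rw [hκ0 _ hK.measurableSet]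
            have : {s : Φ.ker | σ h * s ∈ K} = ∅ := by
              ext s
              simp only [mem_ofPred_eq, mem_empty_iff_false, iff_false]
              refine fun hsK => hh ⟨_, hsK, ?_⟩
              rw [map_mul, hσ, (MonoidHom.mem_ker).1 s.2, mul_one]
            rw [this, measure_empty]
      _ ≤ ν ((↑) ⁻¹' (K⁻¹ * K)) * μH (Φ '' K) := lintegral_indicator_const_le _ _
      _ < ⊤ := ENNReal.mul_lt_top hK2.measure_lt_top (hK.image hc).measure_lt_top
  -- Uniqueness of Haar measure: `lam` is left invariant and finite on compact sets. Positivity of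
  -- the factor is not needed later.
  refine ⟨haarScalarFactor lam μP, ν, inferInstance, fun A hA =>
    ⟨fun h => κ h A, (measurable_coe hA).comp hκm, fun p => hκ p hA, ?_⟩⟩
  rw [← hlam hA]
  conv_lhs => rw [isMulLeftInvariant_eq_smul lam μP]
  simp

/-- The formal properties of the balls, centred at the identity, of a proper left-invariant
distance. -/
structure IsBallFamily {X : Type*} [Group X] [TopologicalSpace X] (B : ℝ → Set X) : Prop where
  isOpen : ∀ r, IsOpen (B r)
  one_mem : ∀ r, 0 < r → 1 ∈ B r
  inv_mem : ∀ {r x}, x ∈ B r → x⁻¹ ∈ B r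
  mul_mem : ∀ {r s x y}, x ∈ B r → y ∈ B s → x * y ∈ B (r + s)
  mono : Monotone B
  subset_isCompact : ∀ r, ∃ K, IsCompact K ∧ B r ⊆ K

theorem IsBallFamily.prod {X Y : Type*} [Group X] [TopologicalSpace X] [Group Y]
    [TopologicalSpace Y] {BX : ℝ → Set X} {BY : ℝ → Set Y} (hX : IsBallFamily BX)
    (hY : IsBallFamily BY) : IsBallFamily fun r => BX r ×ˢ BY r where
  isOpen r := (hX.isOpen r).prod (hY.isOpen r)
  one_mem r hr := ⟨hX.one_mem r hr, hY.one_mem r hr⟩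
  inv_mem h := ⟨hX.inv_mem h.1, hY.inv_mem h.2⟩
  mul_mem h h' := ⟨hX.mul_mem h.1 h'.1, hY.mul_mem h.2 h'.2⟩
  mono _ _ h := prod_mono (hX.mono h) (hY.mono h)
  subset_isCompact r := by
    obtain ⟨K, hK, h⟩ := hX.subset_isCompact r
    obtain ⟨L, hL, h'⟩ := hY.subset_isCompact r
    exact ⟨K ×ˢ L, hK.prod hL, prod_mono h h'⟩

/-- Doubling of balls passes to a quotient of groups, if the balls downstairs are comparable with
the images of the balls upstairs. -/
theorem measure_le_of_quotient_ball {B : ℝ → Set P} (hB : IsBallFamily B) {BH : ℝ → Set H}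
    (Φ : P →* H) (hc : Continuous Φ) (hs : Function.Surjective Φ)
    (μH : Measure H) [μH.IsHaarMeasure] (μP : Measure P) [μP.IsHaarMeasure]
    {C : ℝ≥0} (hdouble : ∀ r, 0 < r → μP (B (2 * r)) ≤ C * μP (B r))
    (himage : ∀ r, 0 < r → ∀ p ∈ B r, Φ p ∈ BH (2 * r))
    (hlift : ∀ r, 0 < r → ∀ h ∈ BH r, ∃ p ∈ B (3 * r), Φ p = h) {r : ℝ} (hr : 0 < r) :
    μH (BH (2 * r)) ≤ C ^ 4 * μH (BH r) := by
  obtain ⟨c, ν, hν, hf⟩ := exists_fiber_haar_lintegral Φ hc hs μH μP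
  have hclosed : IsClosed (Φ.ker : Set P) := by
    have : (Φ.ker : Set P) = Φ ⁻¹' {1} := by ext x; simp [MonoidHom.mem_ker]
    rw [this]
    exact isClosed_singleton.preimage hc
  let K := ν ((↑) ⁻¹' B r)
  have hK0 : K ≠ 0 :=
    (((hB.isOpen r).preimage continuous_subtype_val).measure_pos ν ⟨1, hB.one_mem r hr⟩).ne'
  have hKtop : K ≠ ⊤ := by
    obtain ⟨L, hL, hBL⟩ := hB.subset_isCompact r
    have hL2 : IsCompact ((↑) ⁻¹' L : Set Φ.ker) :=
      hclosed.isClosedEmbedding_subtypeVal.isCompact_preimage hL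
    exact ((measure_mono (preimage_mono hBL)).trans_lt hL2.measure_lt_top).ne
  obtain ⟨f, hfm, hfΦ, hfint⟩ := hf (B (8 * r)) (hB.isOpen _).measurableSet
  obtain ⟨f', -, hfΦ', hfint'⟩ := hf (B (r / 2)) (hB.isOpen _).measurableSet
  -- Over BH(2r) every fibre of B(8r) has measure at least `K`, because a lift in B(6r) times ker Φ
  -- ∩ B(r) stays in B(7r). Markov's inequality concludes.
  have hupper : K * μH (BH (2 * r)) ≤ c * μP (B (8 * r)) := by
    rw [← hfint]
    refine le_trans ?_ (mul_meas_ge_le_lintegral hfm K)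
    gcongr
    intro h hh
    obtain ⟨p, hp, rfl⟩ := hlift _ (by positivity) h hh
    rw [mem_ofPred_eq, hfΦ]
    refine measure_mono fun s hs => ?_
    exact hB.mono (by linarith) (hB.mul_mem hp hs)
  -- A nonempty fibre of B(r/2) lies over BH(r). Measured from one of its points it sits in ker Φ ∩
  -- B(r), so its measure is at most `K`.
  have hlower : c * μP (B (r / 2)) ≤ K * μH (BH r) := by
    rw [← hfint']
    refine le_trans (lintegral_mono fun h => ?_) (lintegral_indicator_const_le (BH r) K)
    obtain ⟨p, rfl⟩ := hs h
    rcases eq_empty_or_nonempty {s : Φ.ker | p * s ∈ B (r / 2)} with he | ⟨s, hsB⟩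
    · rw [hfΦ', he, measure_empty]
      exact zero_le
    · have hps : Φ p = Φ (p * s) := by rw [map_mul, (MonoidHom.mem_ker).1 s.2, mul_one]
      have hmem : Φ p ∈ BH r := by
        rw [hps]
        convert himage (r / 2) (by positivity) _ hsB using 2
        ring
      rw [indicator_of_mem hmem, hps, hfΦ']
      refine measure_mono fun s' hs' => ?_
      have h2 := hB.mul_mem (hB.inv_mem hsB) hs'
      rw [inv_mul_cancel_left] at h2
      exact hB.mono (by linarith) h2
  have h4 : μP (B (8 * r)) ≤ C ^ 4 * μP (B (r / 2)) := by
    have e1 := hdouble (4 * r) (by positivity)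
    have e2 := hdouble (2 * r) (by positivity)
    have e3 := hdouble r hr
    have e4 := hdouble (r / 2) (by positivity)
    rw [show 2 * (4 * r) = 8 * r by ring] at e1
    rw [show 2 * (2 * r) = 4 * r by ring] at e2
    rw [show 2 * (r / 2) = r by ring] at e4
    calc μP (B (8 * r)) ≤ C * (C * (C * (C * μP (B (r / 2))))) := by
          refine e1.trans (mul_le_mul_right (e2.trans (mul_le_mul_right (e3.trans
            (mul_le_mul_right e4 _)) _)) _)
      _ = C ^ 4 * μP (B (r / 2)) := by ring
  have hfinal : K * μH (BH (2 * r)) ≤ K * (C ^ 4 * μH (BH r)) :=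
    calc K * μH (BH (2 * r)) ≤ c * μP (B (8 * r)) := hupper
      _ ≤ c * (C ^ 4 * μP (B (r / 2))) := by gcongr
      _ = C ^ 4 * (c * μP (B (r / 2))) := by ring
      _ ≤ C ^ 4 * (K * μH (BH r)) := by gcongr
      _ = K * (C ^ 4 * μH (BH r)) := by ring
  exact (ENNReal.mul_le_mul_iff_right hK0 hKtop).1 hfinal

end QuotientMeasure
end

/-! ### Lengths and distances of left-invariant metrics. -/

noncomputable section

open MeasureTheory Set Topology Filter

section Metrics

open scoped Bundle

variable {E : Type*} [NormedAddCommGroup E] [NormedSpace ℝ E] {M : Type*} [TopologicalSpace M]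
  {I : ModelWithCorners ℝ E M} {G : Type*} [TopologicalSpace G] [ChartedSpace M G] [Group G]
  {E' : Type*} [NormedAddCommGroup E'] [NormedSpace ℝ E'] {M' : Type*} [TopologicalSpace M']
  {I' : ModelWithCorners ℝ E' M'} {G' : Type*} [TopologicalSpace G'] [ChartedSpace M' G']
  [Group G']

namespace LeftInvariantMetric

/-- The length of a tangent vector. -/
def norm (g : LeftInvariantMetric I G) (x : G) (v : TangentSpace I x) : ℝ :=
  √(g.inner x v v)

/-- The length of a path on the interval `[a, b]`. -/
def length (g : LeftInvariantMetric I G) (γ : ℝ → G) (a b : ℝ) : ℝ≥0∞ :=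
  letI : Bundle.RiemannianBundle (fun x : G => TangentSpace I x) := ⟨g.toRiemannianMetric⟩
  Manifold.pathELength I γ a b

theorem norm_congr (g : LeftInvariantMetric I G) {x y : G} (h : x = y) (v : E) :
    g.norm x v = g.norm y v := by subst h; rfl

theorem norm_mul_left (g : LeftInvariantMetric I G) (a x : G) (v : TangentSpace I x) :
    g.norm (a * x) (mfderiv I I (fun y => a * y) x v) = g.norm x v := by
  rw [norm, g.left_invariant, norm]

theorem length_eq (g : LeftInvariantMetric I G) (γ : ℝ → G) (a b : ℝ) :
    g.length γ a b =
      ∫⁻ t in Ioo a b, ENNReal.ofReal (g.norm (γ t) (mfderiv 𝓘(ℝ, ℝ) I γ t 1)) := by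
  let : Bundle.RiemannianBundle (fun x : G => TangentSpace I x) := ⟨g.toRiemannianMetric⟩
  rw [length, Manifold.pathELength_eq_lintegral_mfderiv_Ioo]
  refine lintegral_congr fun t => ?_
  rw [← ofReal_norm]
  rfl

theorem length_add (g : LeftInvariantMetric I G) (γ : ℝ → G) {a b c : ℝ} (h : a ≤ b)
    (h' : b ≤ c) : g.length γ a b + g.length γ b c = g.length γ a c :=
  letI : Bundle.RiemannianBundle (fun x : G => TangentSpace I x) := ⟨g.toRiemannianMetric⟩
  Manifold.pathELength_add h h'

theorem dist_le_length (g : LeftInvariantMetric I G) {γ : ℝ → G} {a b : ℝ} (hab : a ≤ b)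
    (hγ : ContMDiffOn 𝓘(ℝ, ℝ) I 1 γ (Icc a b)) : g.dist (γ a) (γ b) ≤ g.length γ a b :=
  letI : Bundle.RiemannianBundle (fun x : G => TangentSpace I x) := ⟨g.toRiemannianMetric⟩
  Manifold.riemannianEDist_le_pathELength hγ rfl rfl hab

theorem exists_length_lt (g : LeftInvariantMetric I G) {x y : G} {r : ℝ≥0∞}
    (h : g.dist x y < r) : ∃ γ : ℝ → G, γ 0 = x ∧ γ 1 = y ∧
      ContMDiffOn 𝓘(ℝ, ℝ) I 1 γ (Icc 0 1) ∧ g.length γ 0 1 < r :=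
  letI : Bundle.RiemannianBundle (fun x : G => TangentSpace I x) := ⟨g.toRiemannianMetric⟩
  Manifold.exists_lt_of_riemannianEDist_lt h

theorem dist_self (g : LeftInvariantMetric I G) (x : G) : g.dist x x = 0 :=
  letI : Bundle.RiemannianBundle (fun x : G => TangentSpace I x) := ⟨g.toRiemannianMetric⟩
  Manifold.riemannianEDist_self

theorem dist_comm (g : LeftInvariantMetric I G) (x y : G) : g.dist x y = g.dist y x :=
  letI : Bundle.RiemannianBundle (fun x : G => TangentSpace I x) := ⟨g.toRiemannianMetric⟩
  Manifold.riemannianEDist_comm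

theorem dist_triangle (g : LeftInvariantMetric I G) (x y z : G) :
    g.dist x z ≤ g.dist x y + g.dist y z :=
  letI : Bundle.RiemannianBundle (fun x : G => TangentSpace I x) := ⟨g.toRiemannianMetric⟩
  Manifold.riemannianEDist_triangle

theorem length_comp_le (g : LeftInvariantMetric I G) (g' : LeftInvariantMetric I' G')
    {f : G → G'} (hf : MDifferentiable I I' f)
    (h : ∀ x v, g'.norm (f x) (mfderiv I I' f x v) ≤ g.norm x v) {γ : ℝ → G} {a b : ℝ}
    (hγ : ContMDiffOn 𝓘(ℝ, ℝ) I 1 γ (Icc a b)) :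
    g'.length (f ∘ γ) a b ≤ g.length γ a b := by
  rw [length_eq, length_eq]
  refine setLIntegral_mono' measurableSet_Ioo fun t ht => ENNReal.ofReal_le_ofReal ?_
  have hd : MDifferentiableAt 𝓘(ℝ, ℝ) I γ t :=
    ((hγ t (Ioo_subset_Icc_self ht)).mdifferentiableWithinAt one_ne_zero).mdifferentiableAt
      (Icc_mem_nhds ht.1 ht.2)
  rw [mfderiv_comp t (hf (γ t)) hd]
  exact h _ _

theorem dist_map_le (g : LeftInvariantMetric I G) (g' : LeftInvariantMetric I' G')
    {f : G → G'} (hf : ContMDiff I I' 1 f)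
    (h : ∀ x v, g'.norm (f x) (mfderiv I I' f x v) ≤ g.norm x v) (x y : G) :
    g'.dist (f x) (f y) ≤ g.dist x y := by
  refine le_of_forall_gt fun r hr => ?_
  obtain ⟨γ, rfl, rfl, hγ, hlt⟩ := g.exists_length_lt hr
  exact ((g'.dist_le_length zero_le_one (hf.comp_contMDiffOn hγ)).trans
    (length_comp_le g g' (hf.mdifferentiable one_ne_zero) h hγ)).trans_lt hlt

section LieGroup

/-- The mean value inequality along a path. It serves twice: for a local inverse of a
parametrization near the identity, and for the global projection of SU(2) × ℝ³ to ℝ³. -/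
theorem enorm_sub_le_length (g : LeftInvariantMetric I G) {W : Type*} [NormedAddCommGroup W]
    [NormedSpace ℝ W] {w : G → W} {U : Set G} (hU : IsOpen U)
    (hw : ContMDiffOn I 𝓘(ℝ, W) 1 w U) {C : ℝ≥0}
    (hC : ∀ x ∈ U, ∀ v : TangentSpace I x,
      @Norm.norm W _ (mfderiv I 𝓘(ℝ, W) w x v) ≤ C * g.norm x v)
    {γ : ℝ → G} {a b : ℝ} (hab : a ≤ b) (hγ : ContMDiffOn 𝓘(ℝ, ℝ) I 1 γ (Icc a b))
    (hγU : MapsTo γ (Icc a b) U) : ‖w (γ b) - w (γ a)‖ₑ ≤ C * g.length γ a b := by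
  have hc : ContDiffOn ℝ 1 (w ∘ γ) (Icc a b) :=
    contMDiffOn_iff_contDiffOn.1 (hw.comp hγ hγU)
  refine (enorm_sub_le_lintegral_deriv_of_contDiffOn_Icc hc hab).trans ?_
  rw [← restrict_Ioo_eq_restrict_Icc, length_eq, ← lintegral_const_mul' _ _ ENNReal.coe_ne_top]
  refine setLIntegral_mono' measurableSet_Ioo fun t ht => ?_
  have hd : MDifferentiableAt 𝓘(ℝ, ℝ) I γ t :=
    ((hγ t (Ioo_subset_Icc_self ht)).mdifferentiableWithinAt one_ne_zero).mdifferentiableAt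
      (Icc_mem_nhds ht.1 ht.2)
  have hx := hγU (Ioo_subset_Icc_self ht)
  have hdw : MDifferentiableAt I 𝓘(ℝ, W) w (γ t) :=
    ((hw _ hx).mdifferentiableWithinAt one_ne_zero).mdifferentiableAt (hU.mem_nhds hx)
  have e : ‖deriv (w ∘ γ) t‖ =
      @Norm.norm W _ (mfderiv I 𝓘(ℝ, W) w (γ t) (mfderiv 𝓘(ℝ, ℝ) I γ t 1)) := by
    rw [← fderiv_apply_one_eq_deriv, ← mfderiv_eq_fderiv, mfderiv_comp t hdw hd]
    rfl
  rw [← ofReal_norm, ← ENNReal.ofReal_coe_nnreal, ← ENNReal.ofReal_mul C.coe_nonneg, e]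
  exact ENNReal.ofReal_le_ofReal (hC _ hx _)

end LieGroup

variable [LieGroup I ∞ G] [LieGroup I' ∞ G']

theorem _root_.contMDiff_mul_left_one (a : G) : ContMDiff I I 1 fun y : G => a * y :=
  (contMDiff_mul_left (I := I) (n := ∞) (a := a)).of_le (by simp)

theorem dist_mul_left (g : LeftInvariantMetric I G) (a x y : G) :
    g.dist (a * x) (a * y) = g.dist x y := by
  have h : ∀ a x y : G, g.dist (a * x) (a * y) ≤ g.dist x y := fun a x y =>
    dist_map_le g g (contMDiff_mul_left_one a) (fun x v => (g.norm_mul_left a x v).le) x y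
  refine le_antisymm (h a x y) ?_
  simpa using h a⁻¹ (a * x) (a * y)

/-- A homomorphism intertwines left translations, ψ ∘ L_{x⁻¹} = L_{ψ(x)⁻¹} ∘ ψ, and these are
isometries. A bound on the Lie algebra therefore holds at every point. -/
theorem norm_mfderiv_hom_le (g : LeftInvariantMetric I G) (g' : LeftInvariantMetric I' G')
    (ψ : G →* G') (hψ : ContMDiff I I' 1 ψ)
    (h : ∀ v, g'.norm (ψ 1) (mfderiv I I' ψ 1 v) ≤ g.norm 1 v) (x : G) (v : TangentSpace I x) :
    g'.norm (ψ x) (mfderiv I I' ψ x v) ≤ g.norm x v := by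
  have h' : ∀ e : G, e = 1 → ∀ v, g'.norm (ψ e) (mfderiv I I' ψ e v) ≤ g.norm e v := by
    rintro _ rfl; exact h
  have hd := hψ.mdifferentiable one_ne_zero
  have hl : ∀ a : G, MDifferentiable I I fun y : G => a * y := fun a =>
    (contMDiff_mul_left_one a).mdifferentiable one_ne_zero
  have hl' : ∀ a : G', MDifferentiable I' I' fun y : G' => a * y := fun a =>
    (contMDiff_mul_left_one a).mdifferentiable one_ne_zero
  have key := h' (x⁻¹ * x) (inv_mul_cancel x) (mfderiv I I (fun y => x⁻¹ * y) x v)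
  rw [g.norm_mul_left] at key
  refine le_trans (le_of_eq ?_) key
  rw [← g'.norm_mul_left (ψ x)⁻¹]
  have e1 := mfderiv_comp x (hl' (ψ x)⁻¹ (ψ x)) (hd x)
  have e2 := mfderiv_comp x (hd (x⁻¹ * x)) (hl x⁻¹ x)
  have e3 : (fun y => (ψ x)⁻¹ * y) ∘ ψ = ψ ∘ fun y => x⁻¹ * y := by ext y; simp
  rw [e3] at e1
  have e4 : mfderiv I' I' (fun y => (ψ x)⁻¹ * y) (ψ x) (mfderiv I I' ψ x v) =
      mfderiv I I' ψ (x⁻¹ * x) (mfderiv I I (fun y => x⁻¹ * y) x v) := by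
    have := e1.symm.trans e2
    exact DFunLike.congr_fun this v
  rw [e4]
  exact g'.norm_congr (by simp) _

theorem dist_hom_le (g : LeftInvariantMetric I G) (g' : LeftInvariantMetric I' G')
    (ψ : G →* G') (hψ : ContMDiff I I' 1 ψ)
    (h : ∀ v, g'.norm (ψ 1) (mfderiv I I' ψ 1 v) ≤ g.norm 1 v) (x y : G) :
    g'.dist (ψ x) (ψ y) ≤ g.dist x y :=
  dist_map_le g g' hψ (norm_mfderiv_hom_le g g' ψ hψ h) x y

end LeftInvariantMetric

end Metrics
end

/-! ### Local parametrizations, and subadditive functions bounded by the distance. -/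

noncomputable section

open MeasureTheory Set Topology Filter

section Metrics

variable {E : Type*} [NormedAddCommGroup E] [NormedSpace ℝ E] {M : Type*} [TopologicalSpace M]
  {I : ModelWithCorners ℝ E M} {G : Type*} [TopologicalSpace G] [ChartedSpace M G]

/-- The inverse function theorem for a map from a vector space to a manifold. -/
theorem exists_local_inverse_of_hasMFDerivAt [I.Boundaryless] [IsManifold I 1 G]
    {W : Type*} [NormedAddCommGroup W] [NormedSpace ℝ W] [CompleteSpace W] {F : W → G}
    (hF : ContMDiffAt 𝓘(ℝ, W) I 1 F 0) (J : W ≃L[ℝ] E)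
    (hJ : HasMFDerivAt 𝓘(ℝ, W) I F 0 (J : W →L[ℝ] E)) :
    ∃ w : G → W, ContMDiffAt I 𝓘(ℝ, W) 1 w (F 0) ∧ (∀ᶠ x in 𝓝 (F 0), F (w x) = x) ∧
      ∀ᶠ z in 𝓝 (0 : W), w (F z) = z := by
  let ψ := extChartAt I (F 0)
  have hc : ContDiffAt ℝ 1 (ψ ∘ F) 0 :=
    contMDiffAt_iff_contDiffAt.1 (contMDiffAt_iff_target.1 hF).2
  have hd : HasFDerivAt (ψ ∘ F) (J : W →L[ℝ] E) 0 := by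
    have h := hJ.2
    rw [ModelWithCorners.range_eq_univ] at h
    exact HasFDerivWithinAt.hasFDerivAt h univ_mem
  have hst := hc.hasStrictFDerivAt' hd one_ne_zero
  let v := hc.localInverse hd one_ne_zero
  have hv : ContDiffAt ℝ 1 v (ψ (F 0)) := hc.to_localInverse hd one_ne_zero
  have hv0 : v (ψ (F 0)) = 0 := hc.localInverse_apply_image hd one_ne_zero
  have hright : ∀ᶠ y in 𝓝 (ψ (F 0)), ψ (F (v y)) = y := hst.eventually_right_inverse
  have hleft : ∀ᶠ z in 𝓝 (0 : W), v (ψ (F z)) = z := hst.eventually_left_inverse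
  have hψ : ContinuousAt ψ (F 0) := continuousAt_extChartAt (I := I) (F 0)
  have hw : ContMDiffAt I 𝓘(ℝ, W) 1 (v ∘ ψ) (F 0) :=
    hv.contMDiffAt.comp (F 0) (contMDiffAt_extChartAt (I := I))
  refine ⟨v ∘ ψ, hw, ?_, hleft⟩
  have hcont : Tendsto (fun x => F ((v ∘ ψ) x)) (𝓝 (F 0)) (𝓝 (F 0)) := by
    have h1 : ContinuousAt F ((v ∘ ψ) (F 0)) := by
      rw [Function.comp_apply, hv0]; exact hF.continuousAt
    have h2 := ContinuousAt.comp (f := v ∘ ψ) (x := F 0) h1 hw.continuousAt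
    have h3 : (F ∘ (v ∘ ψ)) (F 0) = F 0 := by simp [hv0]
    rw [ContinuousAt, h3] at h2
    exact h2
  have hsrc : ψ.source ∈ 𝓝 (F 0) := extChartAt_source_mem_nhds (I := I) (F 0)
  filter_upwards [hψ.eventually hright, hsrc, hcont hsrc] with x h1 h2 h3
  exact ψ.injOn h3 h2 h1

variable [Group G] [LieGroup I ∞ G]

namespace LeftInvariantMetric

/-- Left translation moves the estimate at x to a z-derivative at 0 of m(a, z) = w(F(a)F(z)), with a
= w(x). This derivative depends continuously on a and is the identity at a = 0, so its norm stays
below `K` nearby. -/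
theorem eventually_norm_mfderiv_local_inverse_le [I.Boundaryless] (g : LeftInvariantMetric I G)
    {W : Type*} [NormedAddCommGroup W] [NormedSpace ℝ W] [CompleteSpace W] {F : W → G}
    (hF : ContMDiff 𝓘(ℝ, W) I 1 F) (hF1 : F 0 = 1) (J : W ≃L[ℝ] E)
    (hJ : HasMFDerivAt 𝓘(ℝ, W) I F 0 (J : W →L[ℝ] E)) (hnorm : ∀ z, g.norm 1 (J z) = ‖z‖)
    {K : ℝ≥0} (hK : 1 < K) {w : G → W} (hw : ContMDiffAt I 𝓘(ℝ, W) 1 w 1)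
    (hright : ∀ᶠ x in 𝓝 (1 : G), F (w x) = x) (hleft : ∀ᶠ z in 𝓝 (0 : W), w (F z) = z) :
    ∀ᶠ x in 𝓝 (1 : G), ∀ v : TangentSpace I x,
      @Norm.norm W _ (mfderiv I 𝓘(ℝ, W) w x v) ≤ K * g.norm x v := by
  have : IsManifold I ∞ G := inferInstance
  have : IsManifold I 1 G := IsManifold.of_le (n := ∞) (by simp)
  have hw0 : w 1 = 0 := by simpa [hF1] using hleft.self_of_nhds
  let m : W × W → W := fun p => w (F p.1 * F p.2)
  have hm : ContDiffAt ℝ 1 m (0, 0) := by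
    rw [← contMDiffAt_iff_contDiffAt]
    have hmul : ContMDiff (I.prod I) I 1 fun p : G × G => p.1 * p.2 :=
      (contMDiff_mul I ∞).of_le (by simp)
    have h1 : ContMDiff 𝓘(ℝ, W × W) I 1 fun p : W × W => F p.1 * F p.2 :=
      hmul.comp ((hF.comp contDiff_fst.contMDiff).prodMk (hF.comp contDiff_snd.contMDiff))
    refine ContMDiffAt.comp (0, 0) ?_ h1.contMDiffAt
    simpa [hF1] using hw
  have hcont : ContinuousAt (fun a : W => (fderiv ℝ m (a, 0)).comp
      (ContinuousLinearMap.inr ℝ W W)) 0 := by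
    have h1 : ContinuousAt (fderiv ℝ m) (0, 0) :=
      (hm.fderiv_right (m := 0) (by simp)).continuousAt
    have h2 : ContinuousAt (fun a : W => fderiv ℝ m (a, 0)) 0 :=
      ContinuousAt.comp (f := fun a : W => (a, (0 : W))) h1 (by fun_prop)
    exact h2.clm_comp continuousAt_const
  have hid : (fderiv ℝ m (0, 0)).comp (ContinuousLinearMap.inr ℝ W W) =
      ContinuousLinearMap.id ℝ W := by
    have h1 : HasFDerivAt (fun z => m (0, z))
        ((fderiv ℝ m (0, 0)).comp (ContinuousLinearMap.inr ℝ W W)) 0 :=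
      HasFDerivAt.comp (f := fun z : W => ((0 : W), z)) 0
        (hm.differentiableAt one_ne_zero).hasFDerivAt (hasFDerivAt_prodMk_right _ _)
    refine h1.unique ((hasFDerivAt_id (0 : W)).congr_of_eventuallyEq ?_)
    filter_upwards [hleft] with z hz
    simpa [m, hF1] using hz
  have hsmall : ∀ᶠ a in 𝓝 (0 : W), ‖(fderiv ℝ m (a, 0)).comp
      (ContinuousLinearMap.inr ℝ W W)‖ < K := by
    refine hcont.norm.eventually_lt continuousAt_const ?_
    rw [hid]
    exact (ContinuousLinearMap.norm_id_le).trans_lt (by exact_mod_cast hK)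
  have hdiff : ∀ᶠ a in 𝓝 (0 : W), DifferentiableAt ℝ m (a, 0) := by
    have h1 : ∀ᶠ p in 𝓝 ((0, 0) : W × W), ContDiffAt ℝ 1 m p := hm.eventually (by simp)
    have h2 : Tendsto (fun a : W => (a, (0 : W))) (𝓝 0) (𝓝 (0, 0)) :=
      (Continuous.tendsto (by fun_prop) 0)
    filter_upwards [h2.eventually h1] with a ha using ha.differentiableAt one_ne_zero
  have hwt : Tendsto w (𝓝 1) (𝓝 0) := by
    have := hw.continuousAt
    rwa [ContinuousAt, hw0] at this
  have hwd : ∀ᶠ x in 𝓝 (1 : G), MDifferentiableAt I 𝓘(ℝ, W) w x := by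
    filter_upwards [(contMDiffAt_iff_contMDiffAt_nhds (by simp)).1 hw] with x hx using hx.mdifferentiableAt one_ne_zero
  filter_upwards [hright, hwt.eventually hsmall, hwt.eventually hdiff, hwd] with x h1 h2 h3 h4
  intro v
  -- Write v as dLₓ(Jz). Then ‖z‖ is the g-length of v by left invariance, and dw(v) is the partial
  -- derivative of `m` applied to z.
  let v' : E := mfderiv I I (fun y => x⁻¹ * y) x v
  let z : W := J.symm v'
  have hz : ‖z‖ = g.norm x v := by
    rw [← hnorm, J.apply_symm_apply, ← g.norm_mul_left x⁻¹ x v]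
    exact g.norm_congr (by simp) _
  have e1 : HasFDerivAt (fun z => m (w x, z))
      ((fderiv ℝ m (w x, 0)).comp (ContinuousLinearMap.inr ℝ W W)) 0 :=
    HasFDerivAt.comp (f := fun z : W => (w x, z)) 0 h3.hasFDerivAt (hasFDerivAt_prodMk_right _ _)
  have hmx : (fun z => m (w x, z)) = w ∘ (fun y => x * y) ∘ F := by
    ext z; simp [m, h1]
  rw [hmx] at e1
  let Lx : E →L[ℝ] E := mfderiv I I (fun y => x * y) (1 : G)
  have hL : HasMFDerivAt I I (fun y => x * y) (1 : G) Lx :=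
    ((contMDiff_mul_left_one x).mdifferentiable one_ne_zero 1).hasMFDerivAt
  have hL1 : HasMFDerivAt I I (fun y => x * y) (F 0) Lx := by rw [hF1]; exact hL
  have hL2 : HasMFDerivAt I I (fun y => x * y) (x⁻¹ * x) Lx := by
    rw [inv_mul_cancel]; exact hL
  let dw : E →L[ℝ] W := mfderiv I 𝓘(ℝ, W) w x
  have hdw : HasMFDerivAt I 𝓘(ℝ, W) w (x * F 0) dw := by
    rw [hF1, mul_one]; exact h4.hasMFDerivAt
  have e2 : HasFDerivAt (w ∘ (fun y => x * y) ∘ F) (dw.comp (Lx.comp (J : W →L[ℝ] E))) 0 :=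
    (hdw.comp 0 (hL1.comp 0 hJ)).hasFDerivAt
  have e3 : Lx v' = v := by
    have h5 := hL2.comp x
      ((contMDiff_mul_left_one x⁻¹).mdifferentiable one_ne_zero x).hasMFDerivAt
    have h6 : (fun y => x * y) ∘ (fun y => x⁻¹ * y) = id := by ext y; simp
    rw [h6] at h5
    exact DFunLike.congr_fun (hasMFDerivAt_unique h5 (hasMFDerivAt_id x)) v
  have e4 : dw v = (fderiv ℝ m (w x, 0)).comp (ContinuousLinearMap.inr ℝ W W) z := by
    rw [e1.unique e2]
    simp [z, e3]
  have e5 : ‖dw v‖ ≤ K * g.norm x v := by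
    rw [e4, ← hz]
    exact ((ContinuousLinearMap.le_opNorm _ z).trans (by gcongr))
  exact e5

/-- A subadditive function on a Lie group that is bounded by the norm in a parametrization near
the identity, isometric to first order, is bounded by the Riemannian distance. -/
theorem le_mul_dist_of_subadditive [I.Boundaryless] (g : LeftInvariantMetric I G)
    {W : Type*} [NormedAddCommGroup W] [NormedSpace ℝ W] [CompleteSpace W] {F : W → G}
    (hF : ContMDiff 𝓘(ℝ, W) I 1 F) (hF1 : F 0 = 1) (J : W ≃L[ℝ] E)
    (hJ : HasMFDerivAt 𝓘(ℝ, W) I F 0 (J : W →L[ℝ] E)) (hnorm : ∀ z, g.norm 1 (J z) = ‖z‖)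
    {K : ℝ≥0} (hK : 1 < K) {N : G → ℝ≥0∞} (hN : ∀ x y, N (x * y) ≤ N x + N y) (hN1 : N 1 = 0)
    {C : ℝ≥0} (hNF : ∀ z, N (F z) ≤ C * ‖z‖ₑ) {x : G} {r : ℝ≥0∞} (hr : g.dist 1 x < r) :
    ∃ s < r, N x ≤ C * K * s := by
  have : IsManifold I ∞ G := inferInstance
  have : IsManifold I 1 G := IsManifold.of_le (n := ∞) (by simp)
  have : IsTopologicalGroup G := topologicalGroup_of_lieGroup I ∞
  obtain ⟨w, hw, hright, hleft⟩ := exists_local_inverse_of_hasMFDerivAt hF.contMDiffAt J hJ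
  rw [hF1] at hw hright
  have hw0 : w 1 = 0 := by simpa [hF1] using hleft.self_of_nhds
  have hbound := g.eventually_norm_mfderiv_local_inverse_le hF hF1 J hJ hnorm hK hw hright hleft
  have hsmooth := (contMDiffAt_iff_contMDiffAt_nhds (by simp)).1 hw
  obtain ⟨U, hU, hUo, hU1⟩ := eventually_nhds_iff.1 (hright.and (hbound.and hsmooth))
  -- A short piece of path, translated to start at 1, stays in `U`. There `w` is `K`-Lipschitz along
  -- it, and N ∘ F is at most C times the norm.
  have hlocal : ∀ γ : ℝ → G, ∀ a b : ℝ, a ≤ b → ContMDiffOn 𝓘(ℝ, ℝ) I 1 γ (Icc a b) →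
      (∀ t ∈ Icc a b, (γ a)⁻¹ * γ t ∈ U) →
      N ((γ a)⁻¹ * γ b) ≤ C * K * g.length γ a b := by
    intro γ a b hab hγ hγU
    have h1 := g.enorm_sub_le_length (γ := (fun y => (γ a)⁻¹ * y) ∘ γ) hUo
      (fun y hy => (hU y hy).2.2.contMDiffWithinAt) (fun y hy => (hU y hy).2.1) hab
      ((contMDiff_mul_left_one (γ a)⁻¹).comp_contMDiffOn hγ) hγU
    have h2 := length_comp_le g g ((contMDiff_mul_left_one (γ a)⁻¹).mdifferentiable one_ne_zero)
      (fun x v => (g.norm_mul_left (γ a)⁻¹ x v).le) hγ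
    simp only [Function.comp_apply, inv_mul_cancel, hw0, sub_zero] at h1
    have h3 := hNF (w ((γ a)⁻¹ * γ b))
    rw [(hU _ (hγU b (right_mem_Icc.2 hab))).1] at h3
    rw [mul_assoc]
    exact h3.trans (mul_le_mul_right (h1.trans (mul_le_mul_right h2 _)) _)
  have hpath : ∀ γ : ℝ → G, ContMDiffOn 𝓘(ℝ, ℝ) I 1 γ (Icc 0 1) → γ 0 = 1 →
      N (γ 1) ≤ C * K * g.length γ 0 1 := by
    intro γ hγ hγ0
    have hcont : Continuous fun t : Icc (0 : ℝ) 1 => γ t :=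
      continuousOn_iff_continuous_domRestrict.1 hγ.continuousOn
    -- Compactness of the interval yields a finite subdivision whose pieces are all short in this
    -- sense; subadditivity then adds up the local bounds.
    have hcov : ∀ t : Icc (0 : ℝ) 1, ∃ V : Set (Icc (0 : ℝ) 1), IsOpen V ∧ t ∈ V ∧
        ∀ a ∈ V, ∀ b ∈ V, (γ a)⁻¹ * γ b ∈ U := by
      intro t
      have h1 : Tendsto (fun p : Icc (0 : ℝ) 1 × Icc (0 : ℝ) 1 => (γ p.1)⁻¹ * γ p.2)
          (𝓝 (t, t)) (𝓝 1) := by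
        have h2 : Continuous fun p : Icc (0 : ℝ) 1 × Icc (0 : ℝ) 1 => (γ p.1)⁻¹ * γ p.2 :=
          (hcont.comp continuous_fst).inv.mul (hcont.comp continuous_snd)
        simpa using h2.tendsto (t, t)
      have h3 := h1 (hUo.mem_nhds hU1)
      rw [mem_map, nhds_prod_eq, mem_prod_same_iff] at h3
      obtain ⟨V, hV, hVU⟩ := h3
      obtain ⟨V', hV', hVo, htV⟩ := mem_nhds_iff.1 hV
      exact ⟨V', hVo, htV, fun a ha b hb =>
        hVU (show (a, b) ∈ V ×ˢ V from ⟨hV' ha, hV' hb⟩)⟩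
    choose V hVo htV hV using hcov
    obtain ⟨t, ht0, htm, ⟨k, hk⟩, htV'⟩ := exists_monotone_Icc_subset_open_cover_Icc
      (zero_le_one' ℝ) hVo (fun t _ => mem_iUnion.2 ⟨t, htV t⟩)
    have hstep : ∀ i : ℕ, N (γ (t i)) ≤ C * K * g.length γ 0 (t i) := by
      intro i
      induction i with
      | zero => rw [ht0, hγ0, hN1]; exact zero_le
      | succ i ih =>
        obtain ⟨s, hs⟩ := htV' i
        have hle : (t i : ℝ) ≤ t (i + 1) := htm (Nat.le_succ i)
        have h1 := hlocal γ (t i) (t (i + 1)) hle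
          (hγ.mono (Icc_subset_Icc (t i).2.1 (t (i + 1)).2.2)) (fun r hr =>
            hV s _ (hs ⟨le_rfl, hle⟩) ⟨r, (t i).2.1.trans hr.1, hr.2.trans (t (i + 1)).2.2⟩
              (hs ⟨hr.1, hr.2⟩))
        rw [← g.length_add γ (t i).2.1 hle, mul_add]
        calc N (γ (t (i + 1))) = N (γ (t i) * ((γ (t i))⁻¹ * γ (t (i + 1)))) := by simp
          _ ≤ _ := (hN _ _).trans (add_le_add ih h1)
    have := hstep k
    rwa [hk k le_rfl] at this
  obtain ⟨γ, h0, rfl, hγ, hlt⟩ := g.exists_length_lt hr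
  exact ⟨_, hlt, hpath γ hγ h0⟩

end LeftInvariantMetric

end Metrics
end

/-! ### Left-invariant metrics from inner products, and their balls. -/

noncomputable section

open MeasureTheory Set Topology Filter

theorem exists_pos_mul_sq_norm_le {E : Type*} [NormedAddCommGroup E] [NormedSpace ℝ E]
    [FiniteDimensional ℝ E] (β : E →L[ℝ] E →L[ℝ] ℝ) (hpos : ∀ v, v ≠ 0 → 0 < β v v) :
    ∃ c, 0 < c ∧ ∀ v, c * ‖v‖ ^ 2 ≤ β v v := by
  have hcont : Continuous fun v => β v v := by fun_prop
  have key : ∃ c, 0 < c ∧ ∀ v, ‖v‖ = 1 → c ≤ β v v := by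
    rcases (Metric.sphere (0 : E) 1).eq_empty_or_nonempty with h | h
    · refine ⟨1, one_pos, fun v hv => ?_⟩
      have : v ∈ Metric.sphere (0 : E) 1 := by simpa using hv
      simp [h] at this
    · have : ProperSpace E := FiniteDimensional.proper_real E
      obtain ⟨v₀, h₀, hmin⟩ := (isCompact_sphere (0 : E) 1).exists_isMinOn h hcont.continuousOn
      have hv₀ : v₀ ≠ 0 := by
        rintro rfl
        simp at h₀
      exact ⟨β v₀ v₀, hpos v₀ hv₀, fun v hv => hmin (by simpa using hv)⟩
  obtain ⟨c, hc, hle⟩ := key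
  refine ⟨c, hc, fun v => ?_⟩
  rcases eq_or_ne v 0 with rfl | hv
  · simp
  · have hn : ‖v‖ ≠ 0 := norm_ne_zero_iff.2 hv
    have h1 := hle (‖v‖⁻¹ • v) (by rw [_root_.norm_smul, norm_inv, norm_norm, inv_mul_cancel₀ hn])
    simp only [map_smul, smul_apply, smul_eq_mul] at h1
    have h2 : 0 < ‖v‖ := by positivity
    calc c * ‖v‖ ^ 2 ≤ (‖v‖⁻¹ * (‖v‖⁻¹ * β v v)) * ‖v‖ ^ 2 := by gcongr
      _ = β v v := by field_simp

/-- Coercivity, obtained by minimizing the form on the compact unit sphere, bounds its unit ball. A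
Riemannian metric carries this boundedness as a field. -/
theorem isVonNBounded_of_pos {E : Type*} [NormedAddCommGroup E] [NormedSpace ℝ E]
    [FiniteDimensional ℝ E] (β : E →L[ℝ] E →L[ℝ] ℝ) (hpos : ∀ v, v ≠ 0 → 0 < β v v) :
    Bornology.IsVonNBounded ℝ {v : E | β v v < 1} := by
  obtain ⟨c, hc, hle⟩ := exists_pos_mul_sq_norm_le β hpos
  refine (NormedSpace.isVonNBounded_ball ℝ E (√(1 / c))).subset fun v hv => ?_
  rw [mem_ball_zero_iff]
  refine Real.lt_sqrt_of_sq_lt ?_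
  rw [lt_div_iff₀ hc, mul_comm]
  exact (hle v).trans_lt hv

section Metrics

variable {E : Type*} [NormedAddCommGroup E] [NormedSpace ℝ E] {M : Type*} [TopologicalSpace M]
  {I : ModelWithCorners ℝ E M} {G : Type*} [TopologicalSpace G] [ChartedSpace M G]
  [Group G] [LieGroup I ∞ G]

namespace LeftInvariantMetric

/-- The derivative of the left translation by `x⁻¹` at `x`. -/
def translate (I : ModelWithCorners ℝ E M) {G : Type*} [TopologicalSpace G] [ChartedSpace M G]
    [Group G] (x : G) : E →L[ℝ] E :=
  mfderiv I I (fun y => x⁻¹ * y) x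

theorem translate_one {G : Type*} [TopologicalSpace G] [ChartedSpace M G] [Group G] :
    translate I (1 : G) = ContinuousLinearMap.id ℝ E := by
  have h : (fun y : G => (1 : G)⁻¹ * y) = id := by ext; simp
  rw [translate, h]
  exact mfderiv_id

theorem translate_mul_left (a x : G) (v : TangentSpace I x) :
    translate I (a * x) (mfderiv I I (fun y => a * y) x v) = translate I x v := by
  have hl : ∀ a : G, MDifferentiable I I fun y : G => a * y := fun a =>
    (contMDiff_mul_left_one a).mdifferentiable one_ne_zero
  have h := mfderiv_comp x (hl (a * x)⁻¹ (a * x)) (hl a x)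
  have h2 : (fun y => (a * x)⁻¹ * y) ∘ (fun y => a * y) = fun y => x⁻¹ * y := by
    ext y; simp [mul_assoc]
  rw [h2] at h
  exact (DFunLike.congr_fun h v).symm

theorem translate_ne_zero (x : G) {v : E} (hv : v ≠ 0) : translate I x v ≠ 0 := by
  intro h
  apply hv
  have h2 : mfderiv I I (fun y => x⁻¹ * y) x v = (0 : E) := h
  have hl : ∀ a : G, MDifferentiable I I fun y : G => a * y := fun a =>
    (contMDiff_mul_left_one a).mdifferentiable one_ne_zero
  have h3 := mfderiv_comp x (hl x (x⁻¹ * x)) (hl x⁻¹ x)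
  have h4 : (fun y => x * y) ∘ (fun y => x⁻¹ * y) = id := by ext y; simp
  rw [h4, mfderiv_id] at h3
  have h5 := DFunLike.congr_fun h3 v
  have h6 : v = mfderiv I I (fun y => x * y) (x⁻¹ * x) (mfderiv I I (fun y => x⁻¹ * y) x v) := h5
  rw [h6]
  exact (congrArg _ h2).trans (map_zero _)

/-- The left translate to the tangent space at `x` of a bilinear form on the Lie algebra. -/
def translateForm (I : ModelWithCorners ℝ E M) {G : Type*} [TopologicalSpace G]
    [ChartedSpace M G] [Group G] (β : E →L[ℝ] E →L[ℝ] ℝ) (x : G) : E →L[ℝ] E →L[ℝ] ℝ :=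
  β.bilinearComp (translate I x) (translate I x)

/-- The left-invariant metric with a given inner product on the Lie algebra. -/
def ofInner [FiniteDimensional ℝ E] (β : E →L[ℝ] E →L[ℝ] ℝ) (hsymm : ∀ v w, β v w = β w v)
    (hpos : ∀ v, v ≠ 0 → 0 < β v v) : LeftInvariantMetric I G where
  inner x := translateForm (E := E) I β x
  symm x v w := hsymm _ _
  pos x v hv := hpos _ (translate_ne_zero x hv)
  continuousAt x := by
    have : Continuous fun v : E => β (translate I x v) (translate I x v) := by fun_prop
    exact this.continuousAt
  isVonNBounded x :=
    isVonNBounded_of_pos (E := E) (translateForm I β x)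
      fun v hv => hpos _ (translate_ne_zero x hv)
  left_invariant a x v w := by
    change β (translate I (a * x) _) (translate I (a * x) _) = β (translate I x v) (translate I x w)
    rw [translate_mul_left, translate_mul_left]

theorem ofInner_inner_one [FiniteDimensional ℝ E] (β : E →L[ℝ] E →L[ℝ] ℝ)
    (hsymm : ∀ v w, β v w = β w v) (hpos : ∀ v, v ≠ 0 → 0 < β v v) (v w : E) :
    (ofInner β hsymm hpos : LeftInvariantMetric I G).inner 1 v w = β v w := by
  change β (translate I (1 : G) v) (translate I (1 : G) w) = β v w
  rw [translate_one]
  rfl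

/-- The distance along a one-parameter subgroup is bounded by the length of its velocity. -/
theorem dist_one_hom_le (g : LeftInvariantMetric I G) {p : ℝ → G} (hp : ContMDiff 𝓘(ℝ, ℝ) I 1 p)
    (hadd : ∀ s t, p (s + t) = p s * p t) {v : E}
    (hv : HasMFDerivAt 𝓘(ℝ, ℝ) I p 0 ((1 : ℝ →L[ℝ] ℝ).smulRight v)) (s : ℝ) :
    g.dist 1 (p s) ≤ ENNReal.ofReal (|s| * g.norm 1 v) := by
  have hp0 : p 0 = 1 := by simpa using hadd 0 0
  have hspeed : ∀ t, g.norm (p t) (mfderiv 𝓘(ℝ, ℝ) I p t 1) = g.norm 1 v := by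
    intro t
    -- A one-parameter subgroup is a left translate of itself with shifted time, hence has constant
    -- speed.
    have h1 : p = (fun y => p t * y) ∘ p ∘ fun s => s - t := by
      ext s; simp [← hadd]
    have hsub : HasMFDerivAt 𝓘(ℝ, ℝ) 𝓘(ℝ, ℝ) (fun s : ℝ => s - t) t
        (ContinuousLinearMap.id ℝ ℝ) := ((hasFDerivAt_id t).sub_const t).hasMFDerivAt
    have h2 : HasMFDerivAt 𝓘(ℝ, ℝ) I p (t - t) ((1 : ℝ →L[ℝ] ℝ).smulRight v) := by
      rw [sub_self]; exact hv
    have h3 := HasMFDerivAt.comp (f := fun s => s - t) t h2 hsub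
    have h4 := (((contMDiff_mul_left_one (I := I) (p t)).mdifferentiable one_ne_zero
      ((p ∘ fun s => s - t) t)).hasMFDerivAt).comp t h3
    rw [← h1] at h4
    rw [h4.mfderiv]
    have h5 := g.norm_mul_left (p t) (p (t - t)) v
    have h6 := g.norm_congr (show p (t - t) = 1 by simp [hp0]) v
    rw [h6] at h5
    rw [← h5]
    have h7 : (((1 : ℝ →L[ℝ] ℝ).smulRight v).comp (ContinuousLinearMap.id ℝ ℝ)) 1 = v := by simp
    refine (g.norm_congr (show p t = p t * p (t - t) by simp [hp0]) _).trans ?_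
    exact congrArg (fun u : E => g.norm (p t * p (t - t))
      (mfderiv I I (fun y => p t * y) (p (t - t)) u)) h7
  have hpos : ∀ s, 0 ≤ s → g.dist 1 (p s) ≤ ENNReal.ofReal (|s| * g.norm 1 v) := by
    intro s hs
    have h1 := g.dist_le_length hs hp.contMDiffOn
    rw [hp0, length_eq] at h1
    refine h1.trans (le_of_eq ?_)
    simp only [hspeed]
    rw [setLIntegral_const, Real.volume_Ioo, sub_zero, abs_of_nonneg hs, mul_comm,
      ENNReal.ofReal_mul hs]
  rcases le_total 0 s with hs | hs
  · exact hpos s hs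
  · have h1 := hpos (-s) (by linarith)
    rw [abs_neg] at h1
    have h2 := g.dist_mul_left (p s) 1 (p (-s))
    rw [← hadd, mul_one, add_neg_cancel, hp0, g.dist_comm] at h2
    rwa [h2]

theorem mem_ball_one {G : Type*} [TopologicalSpace G] [ChartedSpace M G] [Group G]
    {g : LeftInvariantMetric I G} {r : ℝ} {x : G} :
    x ∈ g.ball 1 r ↔ g.dist 1 x < ENNReal.ofReal r := Iff.rfl

/-- Left invariance turns the triangle inequality and the symmetry of the distance into the product
and inverse rules. Openness at x follows by translating a small ball around 1, so only
neighbourhoods of 1 and relative compactness have to be supplied. -/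
theorem isBallFamily_ball (g : LeftInvariantMetric I G) (hnhds : ∀ r, 0 < r → g.ball 1 r ∈ 𝓝 1)
    (hcomp : ∀ r, ∃ K, IsCompact K ∧ g.ball 1 r ⊆ K) : IsBallFamily (g.ball 1) := by
  have : IsTopologicalGroup G := topologicalGroup_of_lieGroup I ∞
  have hmul : ∀ {r s x y}, x ∈ g.ball 1 r → y ∈ g.ball 1 s → x * y ∈ g.ball 1 (r + s) := by
    intro r s x y hx hy
    rw [mem_ball_one] at *
    have hr : 0 < r := ENNReal.ofReal_pos.1 (zero_le.trans_lt hx)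
    have hs : 0 < s := ENNReal.ofReal_pos.1 (zero_le.trans_lt hy)
    rw [ENNReal.ofReal_add hr.le hs.le]
    have h1 := g.dist_mul_left x 1 y
    rw [mul_one] at h1
    exact (g.dist_triangle 1 x (x * y)).trans_lt (h1 ▸ ENNReal.add_lt_add hx hy)
  have hmono : Monotone (g.ball 1) := fun r s h x hx =>
    lt_of_lt_of_le hx (ENNReal.ofReal_le_ofReal h)
  refine ⟨fun r => ?_, fun r hr => mem_of_mem_nhds (hnhds r hr), ?_, hmul, hmono, hcomp⟩
  · rw [isOpen_iff_mem_nhds]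
    intro x hx
    have hr : 0 < r := ENNReal.ofReal_pos.1 (zero_le.trans_lt (mem_ball_one.1 hx))
    obtain ⟨q, hq1, hq2⟩ := exists_between (mem_ball_one.1 hx)
    have hqt : q ≠ ⊤ := (hq2.trans ENNReal.ofReal_lt_top).ne
    have hqr : q.toReal < r := (ENNReal.lt_ofReal_iff_toReal_lt hqt).1 hq2
    have hxq : x ∈ g.ball 1 q.toReal := by rw [mem_ball_one, ENNReal.ofReal_toReal hqt]; exact hq1
    have h1 : (fun y => x⁻¹ * y) ⁻¹' g.ball 1 (r - q.toReal) ∈ 𝓝 x := by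
      have h2 : ContinuousAt (fun y => x⁻¹ * y) x := by fun_prop
      refine h2.preimage_mem_nhds ?_
      rw [inv_mul_cancel]
      exact hnhds _ (by linarith)
    filter_upwards [h1] with y hy
    simpa using hmul hxq hy
  · intro r x hx
    rw [mem_ball_one] at *
    have h1 := g.dist_mul_left x 1 x⁻¹
    rw [mul_one, mul_inv_cancel, g.dist_comm] at h1
    rwa [← h1]

/-- The inverse function theorem writes points near 1 as F(w(x)) with w(x) small, and such points
are close to 1 by the linear bound. -/
theorem ball_mem_nhds_one [I.Boundaryless] (g : LeftInvariantMetric I G)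
    {W : Type*} [NormedAddCommGroup W] [NormedSpace ℝ W] [CompleteSpace W] {F : W → G}
    (hF : ContMDiff 𝓘(ℝ, W) I 1 F) (hF1 : F 0 = 1) (J : W ≃L[ℝ] E)
    (hJ : HasMFDerivAt 𝓘(ℝ, W) I F 0 (J : W →L[ℝ] E))
    {C : ℝ} (hC : ∀ z, g.dist 1 (F z) ≤ ENNReal.ofReal (C * ‖z‖)) {r : ℝ} (hr : 0 < r) :
    g.ball 1 r ∈ 𝓝 1 := by
  have : IsManifold I ∞ G := inferInstance
  have : IsManifold I 1 G := IsManifold.of_le (n := ∞) (by simp)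
  obtain ⟨w, hw, hright, hleft⟩ := exists_local_inverse_of_hasMFDerivAt hF.contMDiffAt J hJ
  have hw0 : w (F 0) = 0 := hleft.self_of_nhds
  rw [hF1] at hw hright hw0
  have ht : Tendsto (fun x => C * ‖w x‖) (𝓝 1) (𝓝 (C * ‖w 1‖)) :=
    (hw.continuousAt.norm.const_mul C)
  rw [hw0, norm_zero, mul_zero] at ht
  filter_upwards [hright, ht.eventually (gt_mem_nhds hr)] with x h1 h2
  rw [mem_ball_one, ← h1]
  exact (hC _).trans_lt ((ENNReal.ofReal_lt_ofReal_iff hr).2 h2)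

theorem measure_ball [MeasurableSpace G] [BorelSpace G] (g : LeftInvariantMetric I G)
    (μ : Measure G) [μ.IsMulLeftInvariant] (x : G) (r : ℝ) :
    μ (g.ball x r) = μ (g.ball 1 r) := by
  have : IsTopologicalGroup G := topologicalGroup_of_lieGroup I ∞
  rw [← measure_preimage_mul μ x⁻¹ (g.ball 1 r)]
  congr 1
  ext y
  have h := g.dist_mul_left x⁻¹ x y
  rw [inv_mul_cancel] at h
  simp only [ball, mem_preimage, mem_ofPred_eq, h]

end LeftInvariantMetric

end Metrics
end

/-! ### The Lie algebra and the one-parameter subgroups of SU(2). -/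

noncomputable section

open MeasureTheory Set Topology Filter

namespace SU2

/-- The isomorphism of `ℝ³`, with the cross product, to the Lie algebra of traceless
skew-Hermitian matrices. -/
def imag (e : EuclideanSpace ℝ (Fin 3)) : Matrix (Fin 2) (Fin 2) ℂ :=
  !![-(e 0 / 2) * Complex.I, e 1 / 2 - e 2 / 2 * Complex.I;
    -(e 1 / 2) - e 2 / 2 * Complex.I, e 0 / 2 * Complex.I]

/-- The cross product of `ℝ³`. -/
def cross (a b : EuclideanSpace ℝ (Fin 3)) : EuclideanSpace ℝ (Fin 3) :=
  !₂[a 1 * b 2 - a 2 * b 1, a 2 * b 0 - a 0 * b 2, a 0 * b 1 - a 1 * b 0]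

/-- The factors 1/2 and the signs in `imag` are chosen so that no constant appears here. Positively
oriented orthonormal bases of ℝ³ thus become standard Milnor bases. -/
theorem bracket_imag (a b : EuclideanSpace ℝ (Fin 3)) :
    ⁅imag a, imag b⁆ = imag (cross a b) := by
  rw [Ring.lie_def]
  ext i j
  fin_cases i <;> fin_cases j <;> apply Complex.ext <;>
    simp [imag, cross] <;> ring

theorem norm_eq_one_iff (e : EuclideanSpace ℝ (Fin 3)) :
    ‖e‖ = 1 ↔ e 0 ^ 2 + e 1 ^ 2 + e 2 ^ 2 = 1 := by
  rw [EuclideanSpace.norm_eq, Real.sqrt_eq_one, Fin.sum_univ_three]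
  simp

theorem oneParam_mem (e : EuclideanSpace ℝ (Fin 3)) (he : ‖e‖ = 1) (s : ℝ) :
    (!₂[Real.cos (s / 2), -(Real.sin (s / 2) * e 0), -(Real.sin (s / 2) * e 1),
      -(Real.sin (s / 2) * e 2)] : EuclideanSpace ℝ (Fin 4)) ∈
        Metric.sphere (0 : EuclideanSpace ℝ (Fin 4)) 1 := by
  rw [norm_eq_one_iff] at he
  rw [mem_sphere_iff]
  simp
  linear_combination Real.sin (s / 2) ^ 2 * he + Real.sin_sq_add_cos_sq (s / 2)

/-- The one-parameter subgroup of `SU(2)` generated by `imag e`, for a unit vector `e`. -/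
def oneParam (e : EuclideanSpace ℝ (Fin 3)) (he : ‖e‖ = 1) (s : ℝ) : SU2 :=
  toS3.symm ⟨_, oneParam_mem e he s⟩

theorem oneParam_val (e : EuclideanSpace ℝ (Fin 3)) (he : ‖e‖ = 1) (s : ℝ) :
    (oneParam e he s).1 = mat !₂[Real.cos (s / 2), -(Real.sin (s / 2) * e 0),
      -(Real.sin (s / 2) * e 1), -(Real.sin (s / 2) * e 2)] := rfl

theorem oneParam_zero (e : EuclideanSpace ℝ (Fin 3)) (he : ‖e‖ = 1) : oneParam e he 0 = 1 := by
  apply Subtype.ext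
  rw [oneParam_val]
  ext i j
  fin_cases i <;> fin_cases j <;> simp [mat]

/-- The matrix is cos(s/2) + sin(s/2)·(2 `imag` e), and 2 `imag` e squares to −1 because e is a unit
vector, so the claim is the addition theorem for sine and cosine. -/
theorem oneParam_add (e : EuclideanSpace ℝ (Fin 3)) (he : ‖e‖ = 1) (s t : ℝ) :
    oneParam e he (s + t) = oneParam e he s * oneParam e he t := by
  have h := (norm_eq_one_iff e).1 he
  apply Subtype.ext
  rw [Submonoid.coe_mul, oneParam_val, oneParam_val, oneParam_val, add_div, Real.cos_add,
    Real.sin_add]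
  ext i j
  fin_cases i <;> fin_cases j <;> apply Complex.ext <;>
    simp [mat, Matrix.mul_apply, Fin.sum_univ_two, -Complex.ofReal_cos, -Complex.ofReal_sin,
      -Complex.ofReal_add, -Complex.ofReal_mul] <;>
    first
      | ring1
      | linear_combination (Real.sin (s / 2) * Real.sin (t / 2)) * h

theorem contMDiff_oneParam (e : EuclideanSpace ℝ (Fin 3)) (he : ‖e‖ = 1) :
    ContMDiff 𝓘(ℝ, ℝ) (𝓡 3) ω (oneParam e he) := by
  refine contMDiff_of_entry fun i j => ?_
  rw [contMDiff_iff_contDiff]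
  simp only [oneParam_val]
  have hc : ContDiff ℝ ω fun s : ℝ => (Real.cos (s / 2) : ℂ) :=
    Complex.ofRealCLM.contDiff.comp (Real.contDiff_cos.comp (contDiff_id.div_const 2))
  have hs : ContDiff ℝ ω fun s : ℝ => (Real.sin (s / 2) : ℂ) :=
    Complex.ofRealCLM.contDiff.comp (Real.contDiff_sin.comp (contDiff_id.div_const 2))
  fin_cases i <;> fin_cases j <;>
    simp [mat, -Complex.ofReal_cos, -Complex.ofReal_sin] <;> fun_prop

theorem hasDerivAt_oneParam (e : EuclideanSpace ℝ (Fin 3)) (he : ‖e‖ = 1) (i j : Fin 2) :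
    HasDerivAt (fun s => (oneParam e he s).1 i j) (imag e i j) 0 := by
  have hd : HasDerivAt (fun s : ℝ => s / 2) (1 / 2) 0 := (hasDerivAt_id 0).div_const 2
  have hc : HasDerivAt (fun s : ℝ => (Real.cos (s / 2) : ℂ)) 0 0 := by
    have := ((Real.hasDerivAt_cos _).comp (0 : ℝ) hd).ofReal_comp
    simpa [Function.comp_def, -Complex.ofReal_cos] using this
  have hs : HasDerivAt (fun s : ℝ => (Real.sin (s / 2) : ℂ)) (1 / 2) 0 := by
    have := ((Real.hasDerivAt_sin _).comp (0 : ℝ) hd).ofReal_comp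
    simpa [Function.comp_def, -Complex.ofReal_sin] using this
  simp only [oneParam_val]
  fin_cases i <;> fin_cases j <;>
    simp only [mat, imag, Matrix.of_apply, Matrix.cons_val', Matrix.cons_val_zero,
      Matrix.cons_val_one, Fin.zero_eta, Fin.mk_one, Fin.isValue, Matrix.cons_val_fin_one,
      Matrix.cons_val, Complex.ofReal_neg, Complex.ofReal_mul]
  · refine (hc.add (((hs.mul_const _).neg).mul_const _)).congr_deriv ?_
    ring
  · refine (((hs.mul_const _).neg).neg.add (((hs.mul_const _).neg).mul_const _)).congr_deriv ?_
    ring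
  · refine (((hs.mul_const _).neg).add (((hs.mul_const _).neg).mul_const _)).congr_deriv ?_
    ring
  · refine (hc.sub (((hs.mul_const _).neg).mul_const _)).congr_deriv ?_
    ring

/-- The embedding of the tangent space at the identity into the matrices is linear. -/
def su2MatrixLinear : EuclideanSpace ℝ (Fin 3) →ₗ[ℝ] Matrix (Fin 2) (Fin 2) ℂ where
  toFun u := su2Matrix u
  map_add' u v := by
    ext i j
    exact map_add (mfderiv (𝓡 3) 𝓘(ℝ, ℂ) (fun A : SU2 => A.1 i j) 1) u v
  map_smul' c u := by
    ext i j
    exact map_smul (mfderiv (𝓡 3) 𝓘(ℝ, ℂ) (fun A : SU2 => A.1 i j) 1) c u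

/-- The initial velocity of a one-parameter subgroup. -/
def velocity (e : EuclideanSpace ℝ (Fin 3)) (he : ‖e‖ = 1) : EuclideanSpace ℝ (Fin 3) :=
  mfderiv 𝓘(ℝ, ℝ) (𝓡 3) (oneParam e he) 0 (1 : ℝ)

theorem hasMFDerivAt_oneParam (e : EuclideanSpace ℝ (Fin 3)) (he : ‖e‖ = 1) :
    HasMFDerivAt 𝓘(ℝ, ℝ) (𝓡 3) (oneParam e he) 0
      ((1 : ℝ →L[ℝ] ℝ).smulRight (velocity e he) : ℝ →L[ℝ] EuclideanSpace ℝ (Fin 3)) := by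
  have h := (((contMDiff_oneParam e he).mdifferentiable (by simp)) 0).hasMFDerivAt
  let A : ℝ →L[ℝ] EuclideanSpace ℝ (Fin 3) := mfderiv 𝓘(ℝ, ℝ) (𝓡 3) (oneParam e he) 0
  have hA : (1 : ℝ →L[ℝ] ℝ).smulRight (velocity e he) = A := by
    refine ContinuousLinearMap.ext_ring ?_
    exact one_smul ℝ (velocity e he)
  rw [hA]
  exact h

theorem su2Matrix_velocity (e : EuclideanSpace ℝ (Fin 3)) (he : ‖e‖ = 1) :
    su2Matrix (velocity e he) = imag e := by
  ext i j
  let A : EuclideanSpace ℝ (Fin 3) →L[ℝ] ℂ :=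
    mfderiv (𝓡 3) 𝓘(ℝ, ℂ) (fun A : SU2 => A.1 i j) (1 : SU2)
  have h1 : HasMFDerivAt (𝓡 3) 𝓘(ℝ, ℂ) (fun A : SU2 => A.1 i j) (oneParam e he 0) A := by
    rw [oneParam_zero]
    exact (((contMDiff_entry i j).mdifferentiable (by simp)) 1).hasMFDerivAt
  have h2 : HasFDerivAt (fun s => (oneParam e he s).1 i j)
      (A.comp ((1 : ℝ →L[ℝ] ℝ).smulRight (velocity e he))) 0 :=
    (h1.comp 0 (hasMFDerivAt_oneParam e he)).hasFDerivAt
  have h3 := h2.unique (hasDerivAt_oneParam e he i j).hasFDerivAt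
  have h4 : A ((1 : ℝ) • velocity e he) = (1 : ℝ) • imag e i j := DFunLike.congr_fun h3 (1 : ℝ)
  rw [one_smul, one_smul] at h4
  exact h4

theorem imag_eq_zero {e : EuclideanSpace ℝ (Fin 3)} (h : imag e = 0) : e = 0 := by
  have h00 := congrArg Complex.im (congrFun (congrFun h 1) 1)
  have h01 := congrArg Complex.re (congrFun (congrFun h 0) 1)
  have h01' := congrArg Complex.im (congrFun (congrFun h 0) 1)
  simp [imag] at h00 h01 h01'
  ext i
  fin_cases i <;> simp [*]

/-- The linear map sending the standard basis to the velocities of its one-parameter subgroups. -/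
def tangentHom : EuclideanSpace ℝ (Fin 3) →ₗ[ℝ] EuclideanSpace ℝ (Fin 3) :=
  ((EuclideanSpace.basisFun (Fin 3) ℝ).toBasis).constr ℝ fun i =>
    velocity (EuclideanSpace.single i 1) (by simp)

theorem su2Matrix_tangentHom (e : EuclideanSpace ℝ (Fin 3)) :
    su2Matrix (tangentHom e) = imag e := by
  have h : su2MatrixLinear (tangentHom e) = imag e := by
    rw [tangentHom, Module.Basis.constr_apply_fintype, map_sum, Fin.sum_univ_three]
    simp only [map_smul]
    have h1 : ∀ i : Fin 3, su2MatrixLinear (velocity (EuclideanSpace.single i 1) (by simp)) =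
        imag (EuclideanSpace.single i 1) := fun i => su2Matrix_velocity _ _
    simp only [h1]
    ext i j
    fin_cases i <;> fin_cases j <;> simp [imag] <;> ring
  exact h

/-- The embedding into matrices turns `tangentHom` into the injective map `imag`. As an injective
endomorphism of ℝ³ it is an isomorphism, which identifies the tangent space without computing in a
chart. -/
theorem tangentHom_injective : Function.Injective tangentHom := by
  rw [injective_iff_map_eq_zero]
  intro e he
  apply imag_eq_zero
  rw [← su2Matrix_tangentHom, he]
  exact map_zero su2MatrixLinear

/-- The identification of `ℝ³` with the tangent space at the identity of `SU(2)`. -/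
def tangentEquiv : EuclideanSpace ℝ (Fin 3) ≃ₗ[ℝ] EuclideanSpace ℝ (Fin 3) :=
  LinearEquiv.ofInjectiveEndo tangentHom tangentHom_injective

theorem su2Matrix_tangentEquiv (e : EuclideanSpace ℝ (Fin 3)) :
    su2Matrix (tangentEquiv e) = imag e := su2Matrix_tangentHom e

/-- Both sides have the same matrix, and surjectivity of `tangentEquiv` makes the matrix of a
tangent vector determine it. -/
theorem velocity_eq (e : EuclideanSpace ℝ (Fin 3)) (he : ‖e‖ = 1) :
    velocity e he = tangentEquiv e := by
  obtain ⟨e', he'⟩ := tangentEquiv.surjective (velocity e he - tangentEquiv e)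
  have h : su2MatrixLinear (tangentEquiv e') = 0 := by
    rw [he', map_sub]
    exact sub_eq_zero.2 ((su2Matrix_velocity e he).trans (su2Matrix_tangentEquiv e).symm)
  have h2 : e' = 0 := imag_eq_zero ((su2Matrix_tangentEquiv e').symm.trans h)
  rw [h2, map_zero] at he'
  exact (sub_eq_zero.1 he'.symm)

/-- The product of three one-parameter subgroups. -/
def productParam (e : Fin 3 → EuclideanSpace ℝ (Fin 3)) (he : ∀ i, ‖e i‖ = 1)
    (z : EuclideanSpace ℝ (Fin 3)) : SU2 :=
  oneParam (e 0) (he 0) (z 0) * oneParam (e 1) (he 1) (z 1) * oneParam (e 2) (he 2) (z 2)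

theorem contMDiff_productParam (e : Fin 3 → EuclideanSpace ℝ (Fin 3)) (he : ∀ i, ‖e i‖ = 1) :
    ContMDiff 𝓘(ℝ, EuclideanSpace ℝ (Fin 3)) (𝓡 3) ω (productParam e he) := by
  have h : ∀ i : Fin 3, ContMDiff 𝓘(ℝ, EuclideanSpace ℝ (Fin 3)) (𝓡 3) ω
      fun z : EuclideanSpace ℝ (Fin 3) => oneParam (e i) (he i) (z i) := fun i => by
    have h1 : ContDiff ℝ ω fun z : EuclideanSpace ℝ (Fin 3) => z i := by fun_prop
    exact (contMDiff_oneParam (e i) (he i)).comp h1.contMDiff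
  exact ((h 0).mul (h 1)).mul (h 2)

theorem productParam_zero (e : Fin 3 → EuclideanSpace ℝ (Fin 3)) (he : ∀ i, ‖e i‖ = 1) :
    productParam e he 0 = 1 := by
  simp [productParam, oneParam_zero]

/-- The differential at the origin of a product of three one-parameter subgroups. -/
def productVelocity (e : Fin 3 → EuclideanSpace ℝ (Fin 3)) :
    EuclideanSpace ℝ (Fin 3) →L[ℝ] EuclideanSpace ℝ (Fin 3) :=
  LinearMap.toContinuousLinearMap
    (((EuclideanSpace.basisFun (Fin 3) ℝ).toBasis).constr ℝ fun i => tangentEquiv (e i))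

theorem productVelocity_apply (e : Fin 3 → EuclideanSpace ℝ (Fin 3))
    (z : EuclideanSpace ℝ (Fin 3)) : productVelocity e z = ∑ i, z i • tangentEquiv (e i) := by
  simp [productVelocity, Module.Basis.constr_apply_fintype]

/-- It suffices to differentiate along the coordinate axes, where two of the three factors are 1 and
a single one-parameter subgroup remains. -/
theorem hasMFDerivAt_productParam (e : Fin 3 → EuclideanSpace ℝ (Fin 3)) (he : ∀ i, ‖e i‖ = 1) :
    HasMFDerivAt 𝓘(ℝ, EuclideanSpace ℝ (Fin 3)) (𝓡 3) (productParam e he) 0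
      (productVelocity e) := by
  have h := (((contMDiff_productParam e he).mdifferentiable (by simp)) 0).hasMFDerivAt
  let A : EuclideanSpace ℝ (Fin 3) →L[ℝ] EuclideanSpace ℝ (Fin 3) :=
    mfderiv 𝓘(ℝ, EuclideanSpace ℝ (Fin 3)) (𝓡 3) (productParam e he) 0
  have hA : ∀ i, A (EuclideanSpace.single i 1) = tangentEquiv (e i) := by
    intro i
    let l : ℝ →L[ℝ] EuclideanSpace ℝ (Fin 3) :=
      (1 : ℝ →L[ℝ] ℝ).smulRight (EuclideanSpace.single i 1)
    have hl : HasMFDerivAt 𝓘(ℝ, ℝ) 𝓘(ℝ, EuclideanSpace ℝ (Fin 3)) l 0 l :=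
      l.hasFDerivAt.hasMFDerivAt
    have h1 : HasMFDerivAt 𝓘(ℝ, EuclideanSpace ℝ (Fin 3)) (𝓡 3) (productParam e he) (l 0) A := by
      rw [map_zero]; exact h
    have h2 := h1.comp 0 hl
    have h3 : productParam e he ∘ l = oneParam (e i) (he i) := by
      ext s : 1
      fin_cases i <;> simp [l, productParam, oneParam_zero]
    rw [h3] at h2
    have h4 := hasMFDerivAt_unique h2 (hasMFDerivAt_oneParam (e i) (he i))
    have h5 : A ((1 : ℝ) • EuclideanSpace.single i 1) = (1 : ℝ) • velocity (e i) (he i) :=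
      DFunLike.congr_fun h4 (1 : ℝ)
    rw [one_smul, one_smul, velocity_eq] at h5
    exact h5
  have hAe : A = productVelocity e := by
    ext1 z
    have hz : z = ∑ i, z i • EuclideanSpace.single i (1 : ℝ) := by
      ext j; simp [Finset.sum_apply, Pi.single_apply]
    rw [productVelocity_apply]
    conv_lhs => rw [hz]
    simp only [map_sum, map_smul, hA]
  rw [← hAe]
  exact h

end SU2
end

/-! ### Linear algebra of the presentation. -/

noncomputable section

section LinearAlgebra

/-- A positive definite symmetric form has an orthonormal basis. -/
theorem exists_orthonormal_basis_of_pos {V : Type*} [AddCommGroup V] [Module ℝ V]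
    [FiniteDimensional ℝ V] {k : ℕ} (hk : Module.finrank ℝ V = k) (B : V →ₗ[ℝ] V →ₗ[ℝ] ℝ)
    (hsymm : ∀ v w, B v w = B w v) (hpos : ∀ v, v ≠ 0 → 0 < B v v) :
    ∃ b : Module.Basis (Fin k) ℝ V, ∀ i j, B (b i) (b j) = if i = j then 1 else 0 := by
  subst hk
  obtain ⟨v, hv⟩ := LinearMap.BilinForm.exists_orthogonal_basis (B := B) ⟨fun x y => hsymm x y⟩
  have hpos' : ∀ i, 0 < B (v i) (v i) := fun i => hpos _ (v.ne_zero i)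
  have hne : ∀ i, (√(B (v i) (v i)))⁻¹ ≠ 0 := fun i =>
    inv_ne_zero (Real.sqrt_pos.2 (hpos' i)).ne'
  refine ⟨v.isUnitSMul fun i => (hne i).isUnit, fun i j => ?_⟩
  rw [Module.Basis.isUnitSMul_apply, Module.Basis.isUnitSMul_apply]
  simp only [map_smul, LinearMap.smul_apply, smul_eq_mul]
  split_ifs with h
  · subst h
    have h1 := Real.mul_self_sqrt (hpos' i).le
    have h2 := (Real.sqrt_pos.2 (hpos' i)).ne'
    field_simp
    nlinarith
  · have h1 : B (v i) (v j) = 0 := hv h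
    simp [h1]

open SU2

theorem inner_three (a b : EuclideanSpace ℝ (Fin 3)) :
    inner ℝ a b = a 0 * b 0 + a 1 * b 1 + a 2 * b 2 := by
  simp [PiLp.inner_apply, Fin.sum_univ_three]
  ring

/-- A symmetric form on `ℝ³` is diagonal in a positively oriented orthonormal basis. -/
theorem exists_oriented_basis_diagonal
    (Q : EuclideanSpace ℝ (Fin 3) →ₗ[ℝ] EuclideanSpace ℝ (Fin 3) →ₗ[ℝ] ℝ)
    (hsymm : ∀ v w, Q v w = Q w v) :
    ∃ e : OrthonormalBasis (Fin 3) ℝ (EuclideanSpace ℝ (Fin 3)),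
      (∀ i, cross (e i) (e (i + 1)) = e (i + 2)) ∧ ∀ i j, i ≠ j → Q (e i) (e j) = 0 := by
  let A : Matrix (Fin 3) (Fin 3) ℝ := Matrix.of fun i j =>
    Q (EuclideanSpace.single i 1) (EuclideanSpace.single j 1)
  have hA : A.IsHermitian := by
    ext i j
    simp [A, hsymm (EuclideanSpace.single j 1)]
  let q := hA.eigenvectorBasis
  have hQ : ∀ k y, Q (q k) y = hA.eigenvalues k * inner ℝ (q k) y := by
    intro k y
    have h1 := hA.mulVec_eigenvectorBasis k
    have hz : ∀ z : EuclideanSpace ℝ (Fin 3), z = ∑ i, z i • EuclideanSpace.single i (1 : ℝ) := by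
      intro z; ext j; simp [Finset.sum_apply, Pi.single_apply]
    have h2 : Q (q k) y = ∑ j, y j * (A.mulVec (q k)) j := by
      conv_lhs => rw [hz (q k), hz y]
      simp only [map_sum, map_smul, LinearMap.sum_apply, LinearMap.smul_apply, smul_eq_mul,
        Matrix.mulVec, dotProduct, A, Matrix.of_apply]
      refine Finset.sum_congr rfl fun j _ => ?_
      congr 1
      refine Finset.sum_congr rfl fun i _ => ?_
      rw [hsymm, mul_comm]
    rw [h2]
    change ∑ j, y j * (A.mulVec (hA.eigenvectorBasis k)) j = _
    rw [h1, PiLp.inner_apply, Finset.mul_sum]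
    refine Finset.sum_congr rfl fun j _ => ?_
    simp [q]
    ring
  have h00 : inner ℝ (q 0) (q 0) = 1 := by simp
  have h11 : inner ℝ (q 1) (q 1) = 1 := by simp
  have h01 : inner ℝ (q 0) (q 1) = 0 := q.orthonormal.2 (by decide)
  generalize hp : q 0 = p at *
  generalize hr : q 1 = r at *
  have i00 := h00
  have i11 := h11
  have i01 := h01
  rw [inner_three] at h00 h11 h01
  -- Replacing the third eigenvector by the cross product forces positive orientation. Orthogonality
  -- for `Q` needs only that the first two vectors are eigenvectors.
  let f : Fin 3 → EuclideanSpace ℝ (Fin 3) := ![p, r, cross p r]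
  have i02 : inner ℝ p (cross p r) = 0 := by rw [inner_three]; simp [cross]; ring
  have i12 : inner ℝ r (cross p r) = 0 := by rw [inner_three]; simp [cross]; ring
  have i22 : inner ℝ (cross p r) (cross p r) = 1 := by
    rw [inner_three]; simp [cross]
    linear_combination (r 0 * r 0 + r 1 * r 1 + r 2 * r 2) * h00 + h11 -
      (p 0 * r 0 + p 1 * r 1 + p 2 * r 2) * h01
  have hf : Orthonormal ℝ f := by
    rw [orthonormal_iff_ite]
    intro i j
    fin_cases i <;> fin_cases j
    · exact i00
    · exact i01
    · exact i02
    · exact (real_inner_comm _ _).trans i01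
    · exact i11
    · exact i12
    · exact (real_inner_comm _ _).trans i02
    · exact (real_inner_comm _ _).trans i12
    · exact i22
  let b := (basisOfOrthonormalOfCardEqFinrank hf (by simp)).toOrthonormalBasis
    (by rw [coe_basisOfOrthonormalOfCardEqFinrank]; exact hf)
  have hb : ⇑b = f := by simp [b]
  refine ⟨b, ?_, ?_⟩
  · rw [hb]
    intro i
    fin_cases i
    · rfl
    · change cross r (cross p r) = p
      ext j
      fin_cases j <;> simp [cross]
      · linear_combination p 0 * h11 - r 0 * h01
      · linear_combination p 1 * h11 - r 1 * h01
      · linear_combination p 2 * h11 - r 2 * h01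
    · change cross (cross p r) p = r
      ext j
      fin_cases j <;> simp [cross]
      · linear_combination r 0 * h00 - p 0 * h01
      · linear_combination r 1 * h00 - p 1 * h01
      · linear_combination r 2 * h00 - p 2 * h01
  · rw [hb]
    have e0 : ∀ y, Q p y = hA.eigenvalues 0 * inner ℝ p y := by
      intro y; rw [← hp]; exact hQ 0 y
    have e1 : ∀ y, Q r y = hA.eigenvalues 1 * inner ℝ r y := by
      intro y; rw [← hr]; exact hQ 1 y
    have k01 : Q p r = 0 := by rw [e0, i01, mul_zero]
    have k02 : Q p (cross p r) = 0 := by rw [e0, i02, mul_zero]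
    have k12 : Q r (cross p r) = 0 := by rw [e1, i12, mul_zero]
    intro i j hij
    fin_cases i <;> fin_cases j <;>
      first | exact absurd rfl hij | assumption | (rw [hsymm]; assumption)

/-- A positive definite form on `su(2) ⊕ ℝⁿ` is diagonal in a basis adapted to a standard Milnor
basis of `su(2)` and to the subspace `ℝⁿ`. -/
theorem exists_adapted_splitting {n : ℕ}
    (G : (EuclideanSpace ℝ (Fin 3) × EuclideanSpace ℝ (Fin n)) →ₗ[ℝ]
      (EuclideanSpace ℝ (Fin 3) × EuclideanSpace ℝ (Fin n)) →ₗ[ℝ] ℝ)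
    (hsymm : ∀ v w, G v w = G w v) (hpos : ∀ v, v ≠ 0 → 0 < G v v) :
    ∃ (e : OrthonormalBasis (Fin 3) ℝ (EuclideanSpace ℝ (Fin 3)))
      (T : EuclideanSpace ℝ (Fin 3) →ₗ[ℝ] EuclideanSpace ℝ (Fin n))
      (B : EuclideanSpace ℝ (Fin n) ≃ₗ[ℝ] EuclideanSpace ℝ (Fin n)) (a : Fin 3 → ℝ),
      (∀ i, cross (e i) (e (i + 1)) = e (i + 2)) ∧ (∀ i, 0 < a i) ∧
      ∀ x y, G (tangentEquiv x, T x + B y) (tangentEquiv x, T x + B y) =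
        ∑ i, (a i * e.repr x i) ^ 2 + ‖y‖ ^ 2 := by
  let V₃ := EuclideanSpace ℝ (Fin 3)
  let Vₙ := EuclideanSpace ℝ (Fin n)
  let h : Vₙ →ₗ[ℝ] Vₙ →ₗ[ℝ] ℝ := G.compl₁₂ (LinearMap.inr ℝ V₃ Vₙ) (LinearMap.inr ℝ V₃ Vₙ)
  have hh : ∀ y y', h y y' = G (0, y) (0, y') := fun y y' => rfl
  obtain ⟨b, hb⟩ := exists_orthonormal_basis_of_pos (k := n) finrank_euclideanSpace_fin h
    (fun v w => hsymm _ _) (fun v hv => hpos _ (by simpa [Prod.ext_iff] using hv))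
  let B : Vₙ ≃ₗ[ℝ] Vₙ := (EuclideanSpace.basisFun (Fin n) ℝ).toBasis.equiv b (Equiv.refl _)
  have hB : ∀ y, B y = ∑ j, y j • b j := by
    intro y
    have h1 : ∀ j, B (EuclideanSpace.single j 1) = b j := fun j => by
      have h2 := (EuclideanSpace.basisFun (Fin n) ℝ).toBasis.equiv_apply j b (Equiv.refl _)
      simpa using h2
    have hz : y = ∑ j, y j • EuclideanSpace.single j (1 : ℝ) := by
      ext j; simp [Finset.sum_apply, Pi.single_apply]
    conv_lhs => rw [hz]
    simp only [map_sum, map_smul, h1]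
  -- Minus the orthogonal projection to ℝⁿ: the graph of `T₀` is the `G`-orthogonal complement of
  -- ℝⁿ.
  let T₀ : V₃ →ₗ[ℝ] Vₙ := -∑ j, ((G.flip (0, b j)).comp (LinearMap.inl ℝ V₃ Vₙ)).smulRight (b j)
  have hT₀ : ∀ u, T₀ u = -∑ j, G (u, 0) (0, b j) • b j := by
    intro u; simp [T₀]
  let S : V₃ →ₗ[ℝ] V₃ × Vₙ :=
    (LinearMap.prod LinearMap.id T₀).comp (tangentEquiv : V₃ →ₗ[ℝ] V₃)
  have hS : ∀ x, S x = (tangentEquiv x, T₀ (tangentEquiv x)) := fun x => rfl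
  have hSb : ∀ x j, G (S x) (0, b j) = 0 := by
    intro x j
    have h1 : S x = (tangentEquiv x, 0) + (0, T₀ (tangentEquiv x)) := by simp [hS]
    rw [h1, map_add, LinearMap.add_apply, ← hh, hT₀]
    simp only [map_neg, map_sum, map_smul, LinearMap.neg_apply, LinearMap.sum_apply,
      LinearMap.smul_apply, hb, smul_eq_mul]
    simp
  have hSB : ∀ x y, G (S x) (0, y) = 0 := by
    intro x y
    have h1 : ((G (S x)).comp (LinearMap.inr ℝ V₃ Vₙ)) = 0 := b.ext fun j => hSb x j
    exact DFunLike.congr_fun h1 y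
  obtain ⟨e, hcross, hdiag⟩ := exists_oriented_basis_diagonal (G.compl₁₂ S S)
    (fun v w => hsymm _ _)
  have hSpos : ∀ i, 0 < G (S (e i)) (S (e i)) := by
    intro i
    refine hpos _ fun h0 => ?_
    have h1 : tangentEquiv (e i) = 0 := congrArg Prod.fst h0
    exact e.toBasis.ne_zero i (by simpa using h1)
  refine ⟨e, T₀.comp (tangentEquiv : V₃ →ₗ[ℝ] V₃), B, fun i => √(G (S (e i)) (S (e i))), hcross,
    fun i => Real.sqrt_pos.2 (hSpos i), fun x y => ?_⟩
  have h1 : (tangentEquiv x, T₀.comp (tangentEquiv : V₃ →ₗ[ℝ] V₃) x + B y) = S x + (0, B y) := by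
    simp [hS]
  have h2 : G (S x) (S x) = ∑ i, (√(G (S (e i)) (S (e i))) * e.repr x i) ^ 2 := by
    conv_lhs => rw [← e.sum_repr x]
    simp only [map_sum, map_smul, LinearMap.sum_apply, LinearMap.smul_apply, smul_eq_mul]
    refine Finset.sum_congr rfl fun i _ => ?_
    rw [Finset.sum_eq_single i]
    · rw [mul_pow, Real.sq_sqrt (hSpos i).le]
      ring
    · intro j _ hj
      have h4 : G (S (e j)) (S (e i)) = 0 := hdiag j i hj
      simp [h4]
    · simp
  have h3 : G (0, B y) (0, B y) = ‖y‖ ^ 2 := by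
    rw [← hh, hB, EuclideanSpace.real_norm_sq_eq]
    simp only [map_sum, map_smul, LinearMap.sum_apply, LinearMap.smul_apply, smul_eq_mul, hb]
    simp [sq]
  have h4 : G (0, B y) (S x) = 0 := (hsymm _ _).trans (hSB x (B y))
  rw [h1, map_add G, LinearMap.add_apply, map_add, map_add, hSB, h4, h2, h3]
  ring

/-- The linear algebra behind the presentation of a quotient of `SU(2) × ℝⁿ` as a quotient of the
product of `SU(2) × ℝ³`, with a decoupled metric, and of a Euclidean space. -/
theorem exists_decoupled_presentation {n : ℕ} {E : Type*} [NormedAddCommGroup E]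
    [NormedSpace ℝ E]
    (L : (EuclideanSpace ℝ (Fin 3) × EuclideanSpace ℝ (Fin n)) →ₗ[ℝ] E)
    (hL : Function.Surjective L) (β : E →ₗ[ℝ] E →ₗ[ℝ] ℝ)
    (hsymm : ∀ v w, β v w = β w v) (hpos : ∀ v, v ≠ 0 → 0 < β v v) :
    ∃ (e : OrthonormalBasis (Fin 3) ℝ (EuclideanSpace ℝ (Fin 3)))
      (T : EuclideanSpace ℝ (Fin 3) →ₗ[ℝ] EuclideanSpace ℝ (Fin n))
      (B : EuclideanSpace ℝ (Fin n) →ₗ[ℝ] EuclideanSpace ℝ (Fin n)) (a : Fin 3 → ℝ) (d : ℝ)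
      (X : E →ₗ[ℝ] EuclideanSpace ℝ (Fin 3)) (Y : E →ₗ[ℝ] EuclideanSpace ℝ (Fin n)),
      (∀ i, cross (e i) (e (i + 1)) = e (i + 2)) ∧ (∀ i, 0 < a i) ∧ 0 < d ∧
      Function.Surjective B ∧
      (∀ x t, β (L (tangentEquiv x, d⁻¹ • T (e.repr.symm t)))
        (L (tangentEquiv x, d⁻¹ • T (e.repr.symm t))) ≤
          ∑ i, (a i * e.repr x i) ^ 2 + ‖t - d • e.repr x‖ ^ 2) ∧
      (∀ y, β (L (0, B y)) (L (0, B y)) ≤ ‖y‖ ^ 2) ∧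
      (∀ w, L (tangentEquiv (X w), T (X w) + B (Y w)) = w) ∧
      ∀ w, ∑ i, (a i * e.repr (X w) i) ^ 2 + ‖Y w‖ ^ 2 = β w w := by
  obtain ⟨σ, hσ⟩ := LinearMap.exists_rightInverse_of_surjective L (LinearMap.range_eq_top.2 hL)
  have hσ' : ∀ w, L (σ w) = w := fun w => DFunLike.congr_fun hσ w
  -- `π` projects onto ker L along the image of `σ`. Adding its Euclidean norm to the pullback of
  -- `β` gives a positive definite form for which `L` is a contraction and `σ` an isometric section.
  let π := LinearMap.id - σ.comp L
  have hπ : ∀ v, π v = v - σ (L v) := fun v => rfl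
  let G : (EuclideanSpace ℝ (Fin 3) × EuclideanSpace ℝ (Fin n)) →ₗ[ℝ]
      (EuclideanSpace ℝ (Fin 3) × EuclideanSpace ℝ (Fin n)) →ₗ[ℝ] ℝ :=
    β.compl₁₂ L L +
      (innerₗ (EuclideanSpace ℝ (Fin 3))).compl₁₂ ((LinearMap.fst ℝ _ _).comp π)
        ((LinearMap.fst ℝ _ _).comp π) +
      (innerₗ (EuclideanSpace ℝ (Fin n))).compl₁₂ ((LinearMap.snd ℝ _ _).comp π)
        ((LinearMap.snd ℝ _ _).comp π)
  have hG : ∀ v w, G v w = β (L v) (L w) + inner ℝ (π v).1 (π w).1 + inner ℝ (π v).2 (π w).2 :=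
    fun v w => rfl
  have hGv : ∀ v, G v v = β (L v) (L v) + ‖(π v).1‖ ^ 2 + ‖(π v).2‖ ^ 2 := fun v => by
    rw [hG, real_inner_self_eq_norm_sq, real_inner_self_eq_norm_sq]
  have hβ : ∀ w, 0 ≤ β w w := fun w => by
    rcases eq_or_ne w 0 with rfl | hw
    · simp
    · exact (hpos w hw).le
  have hGsymm : ∀ v w, G v w = G w v := fun v w => by
    rw [hG, hG, hsymm, real_inner_comm, real_inner_comm (π w).2]
  have hGpos : ∀ v, v ≠ 0 → 0 < G v v := by
    intro v hv
    rw [hGv]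
    by_cases h : L v = 0
    · have hp : π v = v := by rw [hπ, h, map_zero, sub_zero]
      rw [hp, h]
      have : v.1 ≠ 0 ∨ v.2 ≠ 0 := by
        by_contra! h'
        exact hv (Prod.ext h'.1 h'.2)
      rcases this with h' | h' <;> simp only [map_zero, zero_add] <;> positivity
    · have := hpos _ h
      positivity
  have hGL : ∀ v, β (L v) (L v) ≤ G v v := fun v => by
    rw [hGv, add_assoc]
    exact le_add_of_nonneg_right (by positivity)
  have hGσ : ∀ w, G (σ w) (σ w) = β w w := fun w => by
    have hp : π (σ w) = 0 := by rw [hπ, hσ', sub_self]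
    rw [hGv, hσ', hp]
    simp
  obtain ⟨e, T, B, a, hcross, ha, hform⟩ := exists_adapted_splitting G hGsymm hGpos
  let R : EuclideanSpace ℝ (Fin 3) →ₗ[ℝ] EuclideanSpace ℝ (Fin n) :=
    (B.symm : _ →ₗ[ℝ] _).comp (T.comp (e.repr.symm.toLinearEquiv : _ →ₗ[ℝ] _))
  -- The choice makes d⁻¹R a contraction; the summand 1 keeps d positive even when R = 0.
  let d : ℝ := 1 + ‖LinearMap.toContinuousLinearMap R‖
  have hd : 0 < d := by positivity
  have hR : ∀ s, ‖d⁻¹ • R s‖ ≤ ‖s‖ := by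
    intro s
    have h1 := (LinearMap.toContinuousLinearMap R).le_opNorm s
    rw [norm_smul, norm_inv, Real.norm_of_nonneg hd.le, inv_mul_le_iff₀ hd]
    refine h1.trans ?_
    gcongr
    simp [d]
  -- `X` and `Y` are the coordinates of the isometric lift σ(w) in the adapted splitting, so they
  -- reproduce the norm of w exactly.
  let X : E →ₗ[ℝ] EuclideanSpace ℝ (Fin 3) :=
    (tangentEquiv.symm : _ →ₗ[ℝ] _).comp ((LinearMap.fst ℝ _ _).comp σ)
  let Y : E →ₗ[ℝ] EuclideanSpace ℝ (Fin n) :=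
    (B.symm : _ →ₗ[ℝ] _).comp ((LinearMap.snd ℝ _ _).comp σ - T.comp X)
  have hX : ∀ w, tangentEquiv (X w) = (σ w).1 := fun w => tangentEquiv.apply_symm_apply _
  have hY : ∀ w, T (X w) + B (Y w) = (σ w).2 := fun w => by
    have : B (Y w) = (σ w).2 - T (X w) := B.apply_symm_apply _
    rw [this, add_sub_cancel]
  refine ⟨e, T, B, a, d, X, Y, hcross, ha, hd, B.surjective, fun x t => ?_, fun y => ?_, fun w => ?_,
    fun w => ?_⟩
  -- Split t into d times the coordinates of x and a remainder: the first part yields Tx, the second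
  -- is contracted by d⁻¹R.
  · have h1 : d⁻¹ • T (e.repr.symm t) = T x + B (d⁻¹ • R (t - d • e.repr x)) := by
      have h2 : B (R (t - d • e.repr x)) = T (e.repr.symm (t - d • e.repr x)) :=
        B.apply_symm_apply _
      rw [map_smul, h2]
      simp only [map_sub, map_smul, LinearIsometryEquiv.symm_apply_apply, smul_sub]
      rw [inv_smul_smul₀ hd.ne', add_sub_cancel]
    rw [h1]
    refine (hGL _).trans ?_
    rw [hform]
    have := hR (t - d • e.repr x)
    gcongr
  · have h1 := hform 0 y
    have h2 := hGL (0, B y)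
    simp only [map_zero, zero_add, PiLp.zero_apply, mul_zero] at h1
    refine h2.trans (h1.le.trans ?_)
    simp
  · change L (tangentEquiv (X w), T (X w) + B (Y w)) = w
    rw [hX, hY]
    exact hσ' w
  · rw [← hform, hX, hY]
    exact hGσ w

end LinearAlgebra
end

/-! ### The decoupled metrics on SU(2) × ℝ³. -/

noncomputable section

open MeasureTheory Set Topology Filter

namespace SU2

/-- The coordinates, in the basis of the Lie algebra given by an orthonormal basis of `ℝ³`, of the
first component of an element of `su(2) ⊕ ℝ³`. -/
def milnorCoord (e : OrthonormalBasis (Fin 3) ℝ (EuclideanSpace ℝ (Fin 3))) :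
    (EuclideanSpace ℝ (Fin 3) × EuclideanSpace ℝ (Fin 3)) →L[ℝ] EuclideanSpace ℝ (Fin 3) :=
  (LinearMap.toContinuousLinearMap
    (tangentEquiv.symm.trans e.repr.toLinearEquiv).toLinearMap).comp (ContinuousLinearMap.fst ℝ _ _)

theorem milnorCoord_apply (e : OrthonormalBasis (Fin 3) ℝ (EuclideanSpace ℝ (Fin 3)))
    (x t : EuclideanSpace ℝ (Fin 3)) : milnorCoord e (tangentEquiv x, t) = e.repr x := by
  simp [milnorCoord]

theorem milnorCoord_zero (e : OrthonormalBasis (Fin 3) ℝ (EuclideanSpace ℝ (Fin 3)))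
    (t : EuclideanSpace ℝ (Fin 3)) : milnorCoord e (0, t) = 0 := by
  simpa using milnorCoord_apply e 0 t

/-- The inner product on `su(2) ⊕ ℝ³` for which the vectors `uᵢ + d fᵢ`, of length `aᵢ`, are
orthogonal to each other and to the orthonormal standard basis `(f₁, f₂, f₃)`. -/
def decForm (e : OrthonormalBasis (Fin 3) ℝ (EuclideanSpace ℝ (Fin 3))) (a : Fin 3 → ℝ) (d : ℝ) :
    (EuclideanSpace ℝ (Fin 3) × EuclideanSpace ℝ (Fin 3)) →L[ℝ]
      (EuclideanSpace ℝ (Fin 3) × EuclideanSpace ℝ (Fin 3)) →L[ℝ] ℝ :=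
  (∑ i, (a i) ^ 2 • ((EuclideanSpace.proj i).comp (milnorCoord e)).smulRight
      ((EuclideanSpace.proj i).comp (milnorCoord e))) +
    ∑ i, ((EuclideanSpace.proj i).comp
        (ContinuousLinearMap.snd ℝ _ _ - d • milnorCoord e)).smulRight
      ((EuclideanSpace.proj i).comp (ContinuousLinearMap.snd ℝ _ _ - d • milnorCoord e))

theorem decForm_apply (e : OrthonormalBasis (Fin 3) ℝ (EuclideanSpace ℝ (Fin 3)))
    (a : Fin 3 → ℝ) (d : ℝ) (v w : EuclideanSpace ℝ (Fin 3) × EuclideanSpace ℝ (Fin 3)) :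
    decForm e a d v w = ∑ i, a i ^ 2 * (milnorCoord e v i * milnorCoord e w i) +
      inner ℝ (v.2 - d • milnorCoord e v) (w.2 - d • milnorCoord e w) := by
  rw [decForm, add_apply, add_apply, sum_apply, sum_apply, sum_apply, sum_apply, PiLp.inner_apply]
  simp [mul_comm]

theorem decForm_self (e : OrthonormalBasis (Fin 3) ℝ (EuclideanSpace ℝ (Fin 3)))
    (a : Fin 3 → ℝ) (d : ℝ) (x t : EuclideanSpace ℝ (Fin 3)) :
    decForm e a d (tangentEquiv x, t) (tangentEquiv x, t) =
      ∑ i, (a i * e.repr x i) ^ 2 + ‖t - d • e.repr x‖ ^ 2 := by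
  rw [decForm_apply, milnorCoord_apply, real_inner_self_eq_norm_sq]
  congr 1
  exact Finset.sum_congr rfl fun i _ => by ring

theorem decForm_symm (e : OrthonormalBasis (Fin 3) ℝ (EuclideanSpace ℝ (Fin 3)))
    (a : Fin 3 → ℝ) (d : ℝ) (v w : EuclideanSpace ℝ (Fin 3) × EuclideanSpace ℝ (Fin 3)) :
    decForm e a d v w = decForm e a d w v := by
  rw [decForm_apply, decForm_apply, real_inner_comm]
  congr 1
  exact Finset.sum_congr rfl fun i _ => by ring

theorem decForm_pos (e : OrthonormalBasis (Fin 3) ℝ (EuclideanSpace ℝ (Fin 3)))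
    {a : Fin 3 → ℝ} (ha : ∀ i, 0 < a i) (d : ℝ)
    (v : EuclideanSpace ℝ (Fin 3) × EuclideanSpace ℝ (Fin 3)) (hv : v ≠ 0) :
    0 < decForm e a d v v := by
  obtain ⟨u, t⟩ := v
  obtain ⟨x, rfl⟩ := tangentEquiv.surjective u
  rw [decForm_self]
  by_cases hx : x = 0
  · subst hx
    have ht : t ≠ 0 := by
      rintro rfl
      simp at hv
    simp
    positivity
  · have h1 : ∃ i, e.repr x i ≠ 0 := by
      by_contra! h
      exact hx (e.repr.map_eq_zero_iff.1 (by ext i; simpa using h i))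
    obtain ⟨i, hi⟩ := h1
    have h2 : 0 < ∑ i, (a i * e.repr x i) ^ 2 :=
      Finset.sum_pos' (fun j _ => sq_nonneg _) ⟨i, Finset.mem_univ i,
        by have := mul_ne_zero (ha i).ne' hi; positivity⟩
    positivity

/-- The left-invariant metric on `SU(2) × ℝ³` defined by `decForm`. -/
def decMetric (e : OrthonormalBasis (Fin 3) ℝ (EuclideanSpace ℝ (Fin 3)))
    (a : Fin 3 → ℝ) (ha : ∀ i, 0 < a i) (d : ℝ) : LeftInvariantMetric (modelSU2R 3) (SU2R 3) :=
  LeftInvariantMetric.ofInner (decForm e a d) (decForm_symm e a d) (decForm_pos e ha d)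

variable (e : OrthonormalBasis (Fin 3) ℝ (EuclideanSpace ℝ (Fin 3)))
  (a : Fin 3 → ℝ) (ha : ∀ i, 0 < a i) (d : ℝ)

theorem decMetric_inner_one (v w : EuclideanSpace ℝ (Fin 3) × EuclideanSpace ℝ (Fin 3)) :
    (decMetric e a ha d).inner 1 v w = decForm e a d v w :=
  LeftInvariantMetric.ofInner_inner_one _ _ _ v w

theorem decMetric_norm_one (x t : EuclideanSpace ℝ (Fin 3)) :
    (decMetric e a ha d).norm 1 (tangentEquiv x, t) =
      √(∑ i, (a i * e.repr x i) ^ 2 + ‖t - d • e.repr x‖ ^ 2) := by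
  rw [← decForm_self]
  exact congrArg Real.sqrt (decMetric_inner_one e a ha d _ _)

theorem isDecoupled_decMetric (hcross : ∀ i, cross (e i) (e (i + 1)) = e (i + 2)) :
    IsDecoupled (decMetric e a ha d) := by
  refine ⟨fun i => tangentEquiv (e i), fun i => EuclideanSpace.single i 1, d, ⟨?_, fun i => ?_⟩,
    fun i j => ?_, fun i j hij => ?_, fun i j => ?_⟩
  · have h := (e.toBasis.map tangentEquiv).linearIndependent
    have h2 : ⇑(e.toBasis.map tangentEquiv) = fun i => tangentEquiv (e i) := by ext1 i; simp
    rw [h2] at h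
    exact h
  · rw [su2Matrix_tangentEquiv, su2Matrix_tangentEquiv, su2Matrix_tangentEquiv, bracket_imag,
      hcross]
  · refine (decMetric_inner_one e a ha d ((0 : EuclideanSpace ℝ (Fin 3)), EuclideanSpace.single i 1)
      ((0 : EuclideanSpace ℝ (Fin 3)), EuclideanSpace.single j 1)).trans ?_
    rw [decForm_apply, milnorCoord_zero, milnorCoord_zero]
    simp [EuclideanSpace.inner_single_left]
  · refine (decMetric_inner_one e a ha d (tangentEquiv (e i), d • EuclideanSpace.single i 1)
      (tangentEquiv (e j), d • EuclideanSpace.single j 1)).trans ?_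
    rw [decForm_apply, milnorCoord_apply, milnorCoord_apply]
    simp [hij.symm]
  · refine (decMetric_inner_one e a ha d (tangentEquiv (e i), d • EuclideanSpace.single i 1)
      ((0 : EuclideanSpace ℝ (Fin 3)), EuclideanSpace.single j 1)).trans ?_
    rw [decForm_apply, milnorCoord_apply, milnorCoord_zero]
    simp

end SU2
end

/-! ### Distances and balls of decoupled metrics. -/

noncomputable section

open MeasureTheory Set Topology Filter

theorem LeftInvariantMetric.dist_one_mul_le {E : Type*} [NormedAddCommGroup E] [NormedSpace ℝ E]
    {M : Type*} [TopologicalSpace M] {I : ModelWithCorners ℝ E M} {G : Type*}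
    [TopologicalSpace G] [ChartedSpace M G] [Group G] [LieGroup I ∞ G]
    (g : LeftInvariantMetric I G) (x y : G) :
    g.dist 1 (x * y) ≤ g.dist 1 x + g.dist 1 y := by
  have h1 := g.dist_mul_left x 1 y
  rw [mul_one] at h1
  rw [← h1]
  exact g.dist_triangle 1 x (x * y)

namespace SU2

/-- A smooth map into `ℝⁿ`, seen as a map into the vector group. -/
theorem contMDiff_ofAdd {W : Type*} [NormedAddCommGroup W] [NormedSpace ℝ W] {n : ℕ}
    (l : W →L[ℝ] EuclideanSpace ℝ (Fin n)) :
    ContMDiff 𝓘(ℝ, W) 𝓘(ℝ, EuclideanSpace ℝ (Fin n)) ω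
      fun z => (Multiplicative.ofAdd (l z) : Rvec n) :=
  l.contDiff.contMDiff

theorem hasMFDerivAt_ofAdd {W : Type*} [NormedAddCommGroup W] [NormedSpace ℝ W] {n : ℕ}
    (l : W →L[ℝ] EuclideanSpace ℝ (Fin n)) (z : W) :
    HasMFDerivAt 𝓘(ℝ, W) 𝓘(ℝ, EuclideanSpace ℝ (Fin n))
      (fun z => (Multiplicative.ofAdd (l z) : Rvec n)) z l :=
  l.hasFDerivAt.hasMFDerivAt

theorem dist_oneParam_le {n : ℕ} (g : LeftInvariantMetric (modelSU2R n) (SU2R n))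
    (e : EuclideanSpace ℝ (Fin 3)) (he : ‖e‖ = 1) (f : EuclideanSpace ℝ (Fin n)) (s : ℝ) :
    g.dist 1 (oneParam e he s, Multiplicative.ofAdd (s • f)) ≤
      ENNReal.ofReal (|s| * g.norm 1 (tangentEquiv e, f)) := by
  let l : ℝ →L[ℝ] EuclideanSpace ℝ (Fin n) := (1 : ℝ →L[ℝ] ℝ).smulRight f
  have hp : ContMDiff 𝓘(ℝ, ℝ) (modelSU2R n) 1
      fun s : ℝ => ((oneParam e he s, Multiplicative.ofAdd (l s)) : SU2R n) :=
    ((contMDiff_oneParam e he).prodMk (contMDiff_ofAdd l)).of_le (by simp)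
  refine g.dist_one_hom_le hp (fun s t => ?_) ?_ s
  · rw [oneParam_add, map_add, ofAdd_add]
    rfl
  · have h := (hasMFDerivAt_oneParam e he).prodMk (hasMFDerivAt_ofAdd l 0)
    rw [velocity_eq] at h
    let A : ℝ →L[ℝ] EuclideanSpace ℝ (Fin 3) × EuclideanSpace ℝ (Fin n) :=
      ((1 : ℝ →L[ℝ] ℝ).smulRight (tangentEquiv e)).prod l
    have hA : A = (1 : ℝ →L[ℝ] ℝ).smulRight (tangentEquiv e, f) :=
      ContinuousLinearMap.ext_ring (by simp [A, l])
    have h' : HasMFDerivAt 𝓘(ℝ, ℝ) (modelSU2R n)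
      (fun s : ℝ => ((oneParam e he s, Multiplicative.ofAdd (l s)) : SU2R n)) 0 A := h
    rw [hA] at h'
    exact h'

theorem dist_vector_le {n : ℕ} (g : LeftInvariantMetric (modelSU2R n) (SU2R n))
    (f : EuclideanSpace ℝ (Fin n)) :
    g.dist 1 (1, Multiplicative.ofAdd f) ≤
      ENNReal.ofReal (g.norm 1 ((0 : EuclideanSpace ℝ (Fin 3)), f)) := by
  let l : ℝ →L[ℝ] EuclideanSpace ℝ (Fin n) := (1 : ℝ →L[ℝ] ℝ).smulRight f
  have hp : ContMDiff 𝓘(ℝ, ℝ) (modelSU2R n) 1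
      fun s : ℝ => ((1, Multiplicative.ofAdd (l s)) : SU2R n) :=
    (contMDiff_const.prodMk (contMDiff_ofAdd l)).of_le (by simp)
  have key := g.dist_one_hom_le hp (v := ((0 : EuclideanSpace ℝ (Fin 3)), f)) (fun s t => ?_) ?_ 1
  · simpa [l] using key
  · rw [map_add, ofAdd_add, Prod.mk_mul_mk, one_mul]
  · have h := (hasMFDerivAt_const (I := 𝓘(ℝ, ℝ)) (I' := 𝓡 3) (1 : SU2) (0 : ℝ)).prodMk
      (hasMFDerivAt_ofAdd l 0)
    let A : ℝ →L[ℝ] EuclideanSpace ℝ (Fin 3) × EuclideanSpace ℝ (Fin n) :=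
      (0 : ℝ →L[ℝ] EuclideanSpace ℝ (Fin 3)).prod l
    have hA : A = (1 : ℝ →L[ℝ] ℝ).smulRight ((0 : EuclideanSpace ℝ (Fin 3)), f) :=
      ContinuousLinearMap.ext_ring (by simp [A, l])
    have h' : HasMFDerivAt 𝓘(ℝ, ℝ) (modelSU2R n)
      (fun s : ℝ => ((1, Multiplicative.ofAdd (l s)) : SU2R n)) 0 A := h
    rw [hA] at h'
    exact h'

variable (e : OrthonormalBasis (Fin 3) ℝ (EuclideanSpace ℝ (Fin 3)))
  (a : Fin 3 → ℝ) (ha : ∀ i, 0 < a i) (d : ℝ)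

/-- The point is a product of three one-parameter subgroups with velocities uᵢ + d fᵢ. These have
length exactly aᵢ, so the large constant d costs nothing. -/
theorem decMetric_dist_productParam_le (z : EuclideanSpace ℝ (Fin 3)) :
    (decMetric e a ha d).dist 1
      (productParam e (fun i => e.norm_eq_one i) z, Multiplicative.ofAdd (d • z)) ≤
        ENNReal.ofReal (∑ i, a i * |z i|) := by
  let g := decMetric e a ha d
  let p : Fin 3 → SU2R 3 := fun i => (oneParam (e i) (e.norm_eq_one i) (z i),
    Multiplicative.ofAdd (z i • d • EuclideanSpace.single i 1))
  have hp : ∀ i, g.dist 1 (p i) ≤ ENNReal.ofReal (a i * |z i|) := by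
    intro i
    refine (dist_oneParam_le g (e i) (e.norm_eq_one i) (d • EuclideanSpace.single i 1) (z i)).trans
      (le_of_eq ?_)
    have h := decMetric_norm_one e a ha d (e i) (d • EuclideanSpace.single i 1)
    have h2 : √(∑ j, (a j * e.repr (e i) j) ^ 2 +
        ‖d • EuclideanSpace.single i 1 - d • e.repr (e i)‖ ^ 2) = a i := by
      rw [e.repr_self, sub_self, norm_zero, Finset.sum_eq_single i]
      · simp [Real.sqrt_sq (ha i).le]
      · intro j _ hj
        simp [hj]
      · simp
    rw [h2] at h
    rw [h, mul_comm]
  have hprod : ((productParam e (fun i => e.norm_eq_one i) z,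
      Multiplicative.ofAdd (d • z)) : SU2R 3) = p 0 * p 1 * p 2 := by
    refine Prod.ext rfl ?_
    have : d • z = z 0 • d • EuclideanSpace.single 0 1 + z 1 • d • EuclideanSpace.single 1 1 +
        z 2 • d • EuclideanSpace.single 2 (1 : ℝ) := by
      ext j
      fin_cases j <;> simp [mul_comm]
    change Multiplicative.ofAdd (d • z) = _
    rw [this]
    rfl
  have hnn : ∀ i, 0 ≤ a i * |z i| := fun i => mul_nonneg (ha i).le (abs_nonneg _)
  rw [hprod, Fin.sum_univ_three, ENNReal.ofReal_add (add_nonneg (hnn 0) (hnn 1)) (hnn 2),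
    ENNReal.ofReal_add (hnn 0) (hnn 1)]
  refine (g.dist_one_mul_le _ _).trans (add_le_add ?_ (hp 2))
  exact (g.dist_one_mul_le _ _).trans (add_le_add (hp 0) (hp 1))

theorem productVelocity_repr (x : EuclideanSpace ℝ (Fin 3)) :
    productVelocity e (e.repr x) = tangentEquiv x := by
  rw [productVelocity_apply]
  conv_rhs => rw [← e.sum_repr x]
  simp

theorem decMetric_ball_mem_nhds {r : ℝ} (hr : 0 < r) : (decMetric e a ha d).ball 1 r ∈ 𝓝 1 := by
  let g := decMetric e a ha d
  let he : ∀ i, ‖e i‖ = 1 := fun i => e.norm_eq_one i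
  let W := EuclideanSpace ℝ (Fin 3) × EuclideanSpace ℝ (Fin 3)
  let F : W → SU2R 3 := fun p => (productParam e he p.1, Multiplicative.ofAdd p.2)
  have hF : ContMDiff 𝓘(ℝ, W) (modelSU2R 3) 1 F :=
    (((contMDiff_productParam e he).comp contDiff_fst.contMDiff).prodMk
      (contMDiff_ofAdd (ContinuousLinearMap.snd ℝ _ _))).of_le (by simp)
  have hF1 : F 0 = 1 := Prod.ext (productParam_zero e he) rfl
  let J : W ≃L[ℝ] W :=
    ((e.repr.symm.toLinearEquiv.trans tangentEquiv).toContinuousLinearEquiv).prodCongr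
      (ContinuousLinearEquiv.refl ℝ _)
  let A : W →L[ℝ] W := ((productVelocity e).comp (ContinuousLinearMap.fst ℝ _ _)).prod
    (ContinuousLinearMap.snd ℝ _ _)
  have hJA : A = (J : W →L[ℝ] W) := by
    refine ContinuousLinearMap.ext fun p => ?_
    have := productVelocity_repr e (e.repr.symm p.1)
    rw [e.repr.apply_symm_apply] at this
    exact Prod.ext this rfl
  have hA : HasMFDerivAt 𝓘(ℝ, W) (modelSU2R 3) F 0 A := by
    have hfst : HasMFDerivAt 𝓘(ℝ, W) 𝓘(ℝ, EuclideanSpace ℝ (Fin 3)) (Prod.fst : W → _) 0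
      (ContinuousLinearMap.fst ℝ (EuclideanSpace ℝ (Fin 3)) (EuclideanSpace ℝ (Fin 3))) :=
      hasFDerivAt_fst.hasMFDerivAt
    have hsnd := hasMFDerivAt_ofAdd (ContinuousLinearMap.snd ℝ (EuclideanSpace ℝ (Fin 3))
      (EuclideanSpace ℝ (Fin 3))) (0 : W)
    exact (HasMFDerivAt.comp (f := (Prod.fst : W → _)) (0 : W)
      (hasMFDerivAt_productParam e he) hfst).prodMk hsnd
  rw [hJA] at hA
  refine g.ball_mem_nhds_one (C := ∑ i, a i + (1 + |d|)) hF hF1 J hA (fun p => ?_) hr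
  -- The three one-parameter subgroups already contribute d·p₁ in ℝ³; a translation in ℝ³ supplies
  -- the rest.
  have hsplit : F p = (productParam e he p.1, Multiplicative.ofAdd (d • p.1)) *
      (1, Multiplicative.ofAdd (p.2 - d • p.1)) := by
    refine Prod.ext (by simp [F]) ?_
    change Multiplicative.ofAdd p.2 = Multiplicative.ofAdd (d • p.1 + (p.2 - d • p.1))
    rw [add_sub_cancel]
  have h1 := decMetric_dist_productParam_le e a ha d p.1
  have h2 := dist_vector_le g (p.2 - d • p.1)
  have h3 : g.norm 1 ((0 : EuclideanSpace ℝ (Fin 3)), p.2 - d • p.1) = ‖p.2 - d • p.1‖ := by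
    have := decMetric_norm_one e a ha d 0 (p.2 - d • p.1)
    simpa using this
  rw [h3] at h2
  rw [hsplit]
  refine ((g.dist_one_mul_le _ _).trans (add_le_add h1 h2)).trans ?_
  rw [← ENNReal.ofReal_add (Finset.sum_nonneg fun i _ => mul_nonneg (ha i).le (abs_nonneg _))
    (norm_nonneg _)]
  refine ENNReal.ofReal_le_ofReal ?_
  rw [add_mul, Finset.sum_mul]
  have hp1 : ‖p.1‖ ≤ ‖p‖ := norm_fst_le p
  have hp2 : ‖p.2‖ ≤ ‖p‖ := norm_snd_le p
  refine add_le_add (Finset.sum_le_sum fun i _ => ?_) ?_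
  · have : |p.1 i| ≤ ‖p.1‖ := PiLp.norm_apply_le p.1 i
    exact mul_le_mul_of_nonneg_left (this.trans hp1) (ha i).le
  · calc ‖p.2 - d • p.1‖ ≤ ‖p.2‖ + ‖d • p.1‖ := norm_sub_le _ _
      _ = ‖p.2‖ + |d| * ‖p.1‖ := by rw [norm_smul, Real.norm_eq_abs]
      _ ≤ ‖p‖ + |d| * ‖p‖ := by gcongr
      _ = (1 + |d|) * ‖p‖ := by ring

instance : CompactSpace SU2 := toS3.symm.compactSpace

/-- SU(2) is compact, and the projection to ℝ³ is Lipschitz because the form is coercive and left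
translations do not change the ℝ³ component of a vector. -/
theorem decMetric_ball_subset_isCompact (r : ℝ) :
    ∃ K, IsCompact K ∧ (decMetric e a ha d).ball 1 r ⊆ K := by
  let g := decMetric e a ha d
  obtain ⟨c, hc, hle⟩ := exists_pos_mul_sq_norm_le (decForm e a d) (decForm_pos e ha d)
  let C : ℝ≥0 := ⟨(√c)⁻¹, by positivity⟩
  let w : SU2R 3 → EuclideanSpace ℝ (Fin 3) := fun p => Multiplicative.toAdd p.2
  have hw : ContMDiff (modelSU2R 3) 𝓘(ℝ, EuclideanSpace ℝ (Fin 3)) 1 w :=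
    (contMDiff_snd : ContMDiff (modelSU2R 3) 𝓘(ℝ, EuclideanSpace ℝ (Fin 3)) 1
      (Prod.snd : SU2 × Rvec 3 → Rvec 3))
  let pr := ContinuousLinearMap.snd ℝ (EuclideanSpace ℝ (Fin 3)) (EuclideanSpace ℝ (Fin 3))
  have hdw : ∀ x, HasMFDerivAt (modelSU2R 3) 𝓘(ℝ, EuclideanSpace ℝ (Fin 3)) w x pr := fun x =>
    (hasMFDerivAt_snd x : HasMFDerivAt (modelSU2R 3) 𝓘(ℝ, EuclideanSpace ℝ (Fin 3))
      (Prod.snd : SU2 × Rvec 3 → Rvec 3) x pr)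
  have htrans : ∀ (x : SU2R 3) (v : EuclideanSpace ℝ (Fin 3) × EuclideanSpace ℝ (Fin 3)),
      (LeftInvariantMetric.translate (modelSU2R 3) x v).2 = v.2 := by
    intro x v
    have h1 := (hdw (x⁻¹ * x)).comp x
      ((contMDiff_mul_left_one (I := modelSU2R 3) x⁻¹).mdifferentiable one_ne_zero x).hasMFDerivAt
    have h2 : w ∘ (fun y => x⁻¹ * y) = fun y => w y - w x := by
      ext1 y
      change -w x + w y = _
      abel
    have h3 : HasMFDerivAt 𝓘(ℝ, EuclideanSpace ℝ (Fin 3)) 𝓘(ℝ, EuclideanSpace ℝ (Fin 3))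
        (fun t => t - w x) (w x) (ContinuousLinearMap.id ℝ (EuclideanSpace ℝ (Fin 3))) :=
      ((hasFDerivAt_id (w x)).sub_const (w x)).hasMFDerivAt
    rw [h2] at h1
    exact DFunLike.congr_fun (hasMFDerivAt_unique h1 (h3.comp x (hdw x))) v
  have hbound : ∀ x ∈ (univ : Set (SU2R 3)), ∀ v : TangentSpace (modelSU2R 3) x,
      @Norm.norm (EuclideanSpace ℝ (Fin 3)) _
        (mfderiv (modelSU2R 3) 𝓘(ℝ, EuclideanSpace ℝ (Fin 3)) w x v) ≤ C * g.norm x v := by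
    intro x _ v
    rw [(hdw x).mfderiv]
    let v' := LeftInvariantMetric.translate (modelSU2R 3) x v
    have h1 : g.norm x v = √(decForm e a d v' v') := rfl
    have h2 : ‖pr v‖ ≤ ‖v'‖ := by
      have : pr v = v'.2 := (htrans x v).symm
      rw [this]
      exact norm_snd_le v'
    refine h2.trans ?_
    rw [h1]
    change ‖v'‖ ≤ (√c)⁻¹ * _
    rw [le_inv_mul_iff₀ (Real.sqrt_pos.2 hc)]
    refine Real.le_sqrt_of_sq_le ?_
    rw [mul_pow, Real.sq_sqrt hc.le]
    exact hle v'
  refine ⟨univ ×ˢ (Multiplicative.toAdd ⁻¹' Metric.closedBall 0 (C * r)), ?_, ?_⟩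
  · have : IsCompact (Metric.closedBall (0 : EuclideanSpace ℝ (Fin 3)) (C * r)) :=
      isCompact_closedBall _ _
    exact isCompact_univ.prod this
  · intro x hx
    refine ⟨trivial, ?_⟩
    rw [LeftInvariantMetric.mem_ball_one] at hx
    have hr : 0 < r := ENNReal.ofReal_pos.1 (zero_le.trans_lt hx)
    obtain ⟨γ, h0, h1, hγ, hlt⟩ := g.exists_length_lt hx
    have h2 := g.enorm_sub_le_length isOpen_univ hw.contMDiffOn hbound zero_le_one hγ
      (fun _ _ => trivial)
    have hw1 : w 1 = 0 := rfl
    rw [h0, h1, hw1, sub_zero] at h2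
    have h3 : ‖w x‖ₑ ≤ ENNReal.ofReal (C * r) := by
      rw [ENNReal.ofReal_mul C.coe_nonneg, ENNReal.ofReal_coe_nnreal]
      exact h2.trans (mul_le_mul_right hlt.le _)
    rw [← ofReal_norm, ENNReal.ofReal_le_ofReal_iff (by positivity)] at h3
    exact mem_closedBall_zero_iff.2 h3

theorem isBallFamily_decMetric : IsBallFamily ((decMetric e a ha d).ball 1) :=
  LeftInvariantMetric.isBallFamily_ball _ (fun _ hr => decMetric_ball_mem_nhds e a ha d hr)
    (decMetric_ball_subset_isCompact e a ha d)

end SU2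
end

/-! ### The vector factor and the homomorphisms from the two factors. -/

noncomputable section

open MeasureTheory Set Topology Filter

/-- The Euclidean ball of the vector group. -/
def Rvec.ball (n : ℕ) (r : ℝ) : Set (Rvec n) :=
  {y | ‖Multiplicative.toAdd y‖ < r}

theorem Rvec.isBallFamily_ball (n : ℕ) : IsBallFamily (Rvec.ball n) where
  isOpen r := isOpen_lt (continuous_norm.comp continuous_toAdd) continuous_const
  one_mem r hr := by simpa [Rvec.ball] using hr
  inv_mem h := by simpa [Rvec.ball] using h
  mul_mem h h' := lt_of_le_of_lt (norm_add_le _ _) (add_lt_add h h')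
  mono _ _ h _ hx := lt_of_lt_of_le hx h
  subset_isCompact r := by
    have h : IsCompact (Metric.closedBall (0 : EuclideanSpace ℝ (Fin n)) r) :=
      isCompact_closedBall _ _
    exact ⟨_, h, fun y hy => mem_closedBall_zero_iff.2 (le_of_lt hy)⟩

theorem Rvec.exists_haar (n : ℕ) [MeasurableSpace (Rvec n)] [BorelSpace (Rvec n)] :
    ∃ ν : Measure (Rvec n), ν.IsHaarMeasure ∧
      ∀ r, 0 < r → ν (Rvec.ball n (2 * r)) = 2 ^ n * ν (Rvec.ball n r) := by
  have hm : Measurable (Multiplicative.ofAdd : EuclideanSpace ℝ (Fin n) → Rvec n) :=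
    continuous_ofAdd.measurable
  let ν : Measure (Rvec n) := (volume : Measure (EuclideanSpace ℝ (Fin n))).map Multiplicative.ofAdd
  have hν : ∀ s : Set (Rvec n), MeasurableSet s →
      ν s = (volume : Measure (EuclideanSpace ℝ (Fin n))) (Multiplicative.ofAdd ⁻¹' s) :=
    fun s hs => Measure.map_apply hm hs
  have h1 : IsFiniteMeasureOnCompacts ν := ⟨fun K hK => by
    rw [hν K hK.measurableSet]
    exact IsCompact.measure_lt_top (show IsCompact (K : Set (EuclideanSpace ℝ (Fin n))) from hK)⟩
  have h2 : ν.IsMulLeftInvariant := ⟨fun x => by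
    ext s hs
    have hx : Measurable fun y : Rvec n => x * y := (continuous_const_mul x).measurable
    rw [Measure.map_apply hx hs, hν _ (hx hs), hν s hs]
    exact measure_preimage_add volume (Multiplicative.toAdd x) (Multiplicative.ofAdd ⁻¹' s)⟩
  have h3 : ν.IsOpenPosMeasure := ⟨fun U hU hne => by
    rw [hν U hU.measurableSet]
    exact ((hU.preimage continuous_ofAdd).measure_pos volume hne).ne'⟩
  refine ⟨ν, {}, fun r hr => ?_⟩
  · have hB : ∀ s, ν (Rvec.ball n s) = volume (Metric.ball (0 : EuclideanSpace ℝ (Fin n)) s) := by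
      intro s
      rw [hν _ ((Rvec.isBallFamily_ball n).isOpen s).measurableSet]
      congr 1
      ext y
      simp [Rvec.ball]
    rw [hB, hB, Measure.addHaar_ball_mul_of_pos _ _ two_pos]
    simp [ENNReal.ofReal_pow]

namespace SU2

instance : IsTopologicalGroup SU2 := topologicalGroup_of_lieGroup (𝓡 3) ω

instance : PolishSpace SU2 := toS3.isClosedEmbedding.polishSpace

instance (n : ℕ) : PolishSpace (Rvec n) :=
  inferInstanceAs (PolishSpace (EuclideanSpace ℝ (Fin n)))

/-- The homomorphism `(a, t) ↦ (a, A t)` induced by a linear map `A`. -/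
def mapHom {m n : ℕ} (A : EuclideanSpace ℝ (Fin m) →ₗ[ℝ] EuclideanSpace ℝ (Fin n)) :
    SU2R m →* SU2R n :=
  (MonoidHom.id SU2).prodMap (AddMonoidHom.toMultiplicative A.toAddMonoidHom)

/-- The homomorphism `y ↦ (1, B y)` induced by a linear map `B`. -/
def vecHom {m n : ℕ} (B : EuclideanSpace ℝ (Fin m) →ₗ[ℝ] EuclideanSpace ℝ (Fin n)) :
    Rvec m →* SU2R n :=
  (MonoidHom.inr SU2 (Rvec n)).comp (AddMonoidHom.toMultiplicative B.toAddMonoidHom)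

/-- The image of `vecHom` is central; hence the two homomorphisms combine into one on the product
group. -/
theorem commute_mapHom_vecHom {l m n : ℕ}
    (A : EuclideanSpace ℝ (Fin l) →ₗ[ℝ] EuclideanSpace ℝ (Fin n))
    (B : EuclideanSpace ℝ (Fin m) →ₗ[ℝ] EuclideanSpace ℝ (Fin n)) (x : SU2R l) (y : Rvec m) :
    Commute (mapHom A x) (vecHom B y) :=
  Prod.ext ((mul_one x.1).trans (one_mul x.1).symm) (mul_comm _ _)

theorem contMDiff_mapHom {m n : ℕ}
    (A : EuclideanSpace ℝ (Fin m) →ₗ[ℝ] EuclideanSpace ℝ (Fin n)) :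
    ContMDiff (modelSU2R m) (modelSU2R n) ω (mapHom A) := by
  have hA : ContMDiff 𝓘(ℝ, EuclideanSpace ℝ (Fin m)) 𝓘(ℝ, EuclideanSpace ℝ (Fin n)) ω
      (fun t : Rvec m => (Multiplicative.ofAdd (A (Multiplicative.toAdd t)) : Rvec n)) :=
    contMDiff_ofAdd (LinearMap.toContinuousLinearMap A)
  exact contMDiff_id.prodMap hA

theorem hasMFDerivAt_mapHom {m n : ℕ}
    (A : EuclideanSpace ℝ (Fin m) →ₗ[ℝ] EuclideanSpace ℝ (Fin n)) :
    HasMFDerivAt (modelSU2R m) (modelSU2R n) (mapHom A) 1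
      ((ContinuousLinearMap.id ℝ (EuclideanSpace ℝ (Fin 3))).prodMap
        (LinearMap.toContinuousLinearMap A)) := by
  let A' := LinearMap.toContinuousLinearMap A
  have hA : HasMFDerivAt 𝓘(ℝ, EuclideanSpace ℝ (Fin m)) 𝓘(ℝ, EuclideanSpace ℝ (Fin n))
      (fun t : Rvec m => (Multiplicative.ofAdd (A (Multiplicative.toAdd t)) : Rvec n))
      (1 : SU2R m).2 A' :=
    hasMFDerivAt_ofAdd A' 0
  have hfst : HasMFDerivAt (modelSU2R m) (𝓡 3) (Prod.fst : SU2R m → SU2) 1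
      (ContinuousLinearMap.fst ℝ (EuclideanSpace ℝ (Fin 3)) (EuclideanSpace ℝ (Fin m))) :=
    hasMFDerivAt_fst 1
  have hsnd : HasMFDerivAt (modelSU2R m) 𝓘(ℝ, EuclideanSpace ℝ (Fin m))
      (Prod.snd : SU2R m → Rvec m) 1
      (ContinuousLinearMap.snd ℝ (EuclideanSpace ℝ (Fin 3)) (EuclideanSpace ℝ (Fin m))) :=
    hasMFDerivAt_snd 1
  exact hfst.prodMk (hA.comp (1 : SU2R m) hsnd)

theorem continuous_vecHom {m n : ℕ}
    (B : EuclideanSpace ℝ (Fin m) →ₗ[ℝ] EuclideanSpace ℝ (Fin n)) : Continuous (vecHom B) :=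
  continuous_const.prodMk (continuous_ofAdd.comp
    (B.continuous_of_finiteDimensional.comp continuous_toAdd))

end SU2
end

/-! ### Upper bounds for distances in the quotient. -/

noncomputable section

open MeasureTheory Set Topology Filter

namespace SU2

variable {n : ℕ} {E : Type*} [NormedAddCommGroup E] [NormedSpace ℝ E]
  {M : Type*} [TopologicalSpace M] {I : ModelWithCorners ℝ E M}
  {H : Type*} [TopologicalSpace H] [ChartedSpace M H] [Group H] {φ : SU2R n →* H}
  {L : EuclideanSpace ℝ (Fin 3) × EuclideanSpace ℝ (Fin n) →L[ℝ] E}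

/-- The parametrization of `H` by the images of products of one-parameter subgroups. -/
theorem hasMFDerivAt_comp_productParam (hφ : ContMDiff (modelSU2R n) I 1 φ)
    (hL : HasMFDerivAt (modelSU2R n) I φ 1 L)
    {W : Type*} [NormedAddCommGroup W] [NormedSpace ℝ W]
    (e : OrthonormalBasis (Fin 3) ℝ (EuclideanSpace ℝ (Fin 3)))
    (X : W →L[ℝ] EuclideanSpace ℝ (Fin 3)) (S : W →L[ℝ] EuclideanSpace ℝ (Fin n))
    {J : W →L[ℝ] E} (hJ : ∀ z, L (tangentEquiv (X z), S z) = J z) :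
    ContMDiff 𝓘(ℝ, W) I 1 (fun z => φ (productParam e (fun i => e.norm_eq_one i) (e.repr (X z)),
      Multiplicative.ofAdd (S z))) ∧
    HasMFDerivAt 𝓘(ℝ, W) I (fun z => φ (productParam e (fun i => e.norm_eq_one i) (e.repr (X z)),
      Multiplicative.ofAdd (S z))) 0 J := by
  let he : ∀ i, ‖e i‖ = 1 := fun i => e.norm_eq_one i
  let X' : W →L[ℝ] EuclideanSpace ℝ (Fin 3) :=
    (e.repr.toContinuousLinearEquiv : _ →L[ℝ] EuclideanSpace ℝ (Fin 3)).comp X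
  let q : W → SU2R n := fun z => (productParam e he (X' z), Multiplicative.ofAdd (S z))
  have hq : ContMDiff 𝓘(ℝ, W) (modelSU2R n) 1 q :=
    (((contMDiff_productParam e he).comp X'.contDiff.contMDiff).prodMk
      (contMDiff_ofAdd S)).of_le (by simp)
  have hq0 : q 0 = 1 := by
    refine Prod.ext ?_ ?_
    · change productParam e he (X' 0) = 1
      rw [map_zero, productParam_zero]
    · change Multiplicative.ofAdd (S 0) = 1
      rw [map_zero, ofAdd_zero]
  let A : W →L[ℝ] EuclideanSpace ℝ (Fin 3) × EuclideanSpace ℝ (Fin n) :=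
    ((productVelocity e).comp X').prod S
  have hX : HasMFDerivAt 𝓘(ℝ, W) 𝓘(ℝ, EuclideanSpace ℝ (Fin 3)) X' 0 X' :=
    X'.hasFDerivAt.hasMFDerivAt
  have hp : HasMFDerivAt 𝓘(ℝ, EuclideanSpace ℝ (Fin 3)) (𝓡 3) (productParam e he) (X' 0)
      (productVelocity e) := by
    rw [map_zero]
    exact hasMFDerivAt_productParam e he
  have hA : HasMFDerivAt 𝓘(ℝ, W) (modelSU2R n) q 0 A :=
    (hp.comp 0 hX).prodMk (hasMFDerivAt_ofAdd S 0)
  have hL' : HasMFDerivAt (modelSU2R n) I φ (q 0) L := by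
    rw [hq0]
    exact hL
  have hd : HasMFDerivAt 𝓘(ℝ, W) I (φ ∘ q) 0 (L.comp A) := hL'.comp 0 hA
  have hv : L.comp A = J := by
    refine ContinuousLinearMap.ext fun z => ?_
    rw [← hJ z, ← productVelocity_repr e]
    rfl
  exact ⟨hφ.comp hq, hd.congr_mfderiv hv⟩

variable [LieGroup I ∞ H] (g : LeftInvariantMetric I H)

theorem dist_comp_mapHom_le (hφ : ContMDiff (modelSU2R n) I 1 φ)
    (hL : HasMFDerivAt (modelSU2R n) I φ 1 L) {m : ℕ}
    (g' : LeftInvariantMetric (modelSU2R m) (SU2R m))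
    (A : EuclideanSpace ℝ (Fin m) →ₗ[ℝ] EuclideanSpace ℝ (Fin n))
    (h : ∀ (x : EuclideanSpace ℝ (Fin 3)) (t : EuclideanSpace ℝ (Fin m)),
      g.norm 1 (L (x, A t)) ≤ g'.norm 1 (x, t)) (p : SU2R m) :
    g.dist 1 (φ (mapHom A p)) ≤ g'.dist 1 p := by
  let A' : EuclideanSpace ℝ (Fin 3) × EuclideanSpace ℝ (Fin m) →L[ℝ]
      EuclideanSpace ℝ (Fin 3) × EuclideanSpace ℝ (Fin n) :=
    (ContinuousLinearMap.id ℝ (EuclideanSpace ℝ (Fin 3))).prodMap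
      (LinearMap.toContinuousLinearMap A)
  have hs : ContMDiff (modelSU2R m) I 1 (φ.comp (mapHom A)) :=
    hφ.comp ((contMDiff_mapHom A).of_le (by simp))
  have hL' : HasMFDerivAt (modelSU2R n) I φ (mapHom A 1) L := by
    rw [map_one]
    exact hL
  have hd : HasMFDerivAt (modelSU2R m) I (φ.comp (mapHom A)) 1 (L.comp A') :=
    hL'.comp 1 (hasMFDerivAt_mapHom A)
  have key := LeftInvariantMetric.dist_hom_le g' g (φ.comp (mapHom A)) hs (fun v => ?_) 1 p
  · rw [map_one] at key
    exact key
  · rw [hd.mfderiv]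
    refine (g.norm_congr (map_one (φ.comp (mapHom A))) (L (A' v))).trans_le ?_
    exact h v.1 v.2

theorem dist_comp_vecHom_le (hφ : ContMDiff (modelSU2R n) I 1 φ)
    (hL : HasMFDerivAt (modelSU2R n) I φ 1 L) {m : ℕ}
    (B : EuclideanSpace ℝ (Fin m) →ₗ[ℝ] EuclideanSpace ℝ (Fin n)) (y : EuclideanSpace ℝ (Fin m)) :
    g.dist 1 (φ (vecHom B (Multiplicative.ofAdd y))) ≤
      ENNReal.ofReal (g.norm 1 (L (0, B y))) := by
  let l : ℝ →L[ℝ] EuclideanSpace ℝ (Fin n) := (1 : ℝ →L[ℝ] ℝ).smulRight (B y)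
  let q : ℝ → SU2R n := fun s => (1, Multiplicative.ofAdd (l s))
  have hq : ContMDiff 𝓘(ℝ, ℝ) (modelSU2R n) 1 q :=
    (contMDiff_const.prodMk (contMDiff_ofAdd l)).of_le (by simp)
  have hq0 : q 0 = 1 := by simp [q]
  let A : ℝ →L[ℝ] EuclideanSpace ℝ (Fin 3) × EuclideanSpace ℝ (Fin n) :=
    (0 : ℝ →L[ℝ] EuclideanSpace ℝ (Fin 3)).prod l
  have hA : HasMFDerivAt 𝓘(ℝ, ℝ) (modelSU2R n) q 0 A :=
    (hasMFDerivAt_const (I := 𝓘(ℝ, ℝ)) (I' := 𝓡 3) (1 : SU2) (0 : ℝ)).prodMk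
      (hasMFDerivAt_ofAdd l 0)
  have hL' : HasMFDerivAt (modelSU2R n) I φ (q 0) L := by
    rw [hq0]
    exact hL
  have hd : HasMFDerivAt 𝓘(ℝ, ℝ) I (φ ∘ q) 0 (L.comp A) := hL'.comp 0 hA
  have hv : L.comp A = (1 : ℝ →L[ℝ] ℝ).smulRight (L (0, B y)) :=
    ContinuousLinearMap.ext_ring (by simp [A, l])
  have hd' : HasMFDerivAt 𝓘(ℝ, ℝ) I (φ ∘ q) 0 ((1 : ℝ →L[ℝ] ℝ).smulRight (L (0, B y))) :=
    hd.congr_mfderiv hv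
  have key := g.dist_one_hom_le (p := φ ∘ q) (hφ.comp hq) (fun s t => ?_) hd' 1
  · rw [abs_one, one_mul] at key
    refine le_trans (le_of_eq ?_) key
    have : vecHom B (Multiplicative.ofAdd y) = q 1 := by
      refine Prod.ext rfl ?_
      change Multiplicative.ofAdd (B y) = Multiplicative.ofAdd (l 1)
      simp [l]
    rw [this]
    rfl
  · change φ (q (s + t)) = φ (q s) * φ (q t)
    rw [← map_mul]
    simp [q, ofAdd_add]

end SU2
end

/-! ### The presentation of the quotient and the lifting of balls. -/

noncomputable section

open MeasureTheory Set Topology Filter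

/-- A positive definite symmetric form on a finite-dimensional space is isometric to the
Euclidean one. -/
theorem exists_euclidean_isometry {E : Type*} [NormedAddCommGroup E] [NormedSpace ℝ E]
    [FiniteDimensional ℝ E] (β : E →ₗ[ℝ] E →ₗ[ℝ] ℝ)
    (hsymm : ∀ v w, β v w = β w v) (hpos : ∀ v, v ≠ 0 → 0 < β v v) :
    ∃ J : EuclideanSpace ℝ (Fin (Module.finrank ℝ E)) ≃L[ℝ] E, ∀ z, β (J z) (J z) = ‖z‖ ^ 2 := by
  obtain ⟨b, hb⟩ := exists_orthonormal_basis_of_pos rfl β hsymm hpos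
  refine ⟨((WithLp.linearEquiv 2 ℝ _).trans b.equivFun.symm).toContinuousLinearEquiv, fun z => ?_⟩
  change β (b.equivFun.symm z.ofLp) (b.equivFun.symm z.ofLp) = _
  rw [b.equivFun_symm_apply, EuclideanSpace.real_norm_sq_eq]
  simp only [map_sum, map_smul, LinearMap.sum_apply, LinearMap.smul_apply, smul_eq_mul, hb]
  simp [sq]

/-- The inner product of a left-invariant metric on the Lie algebra. -/
def LeftInvariantMetric.form {E : Type*} [NormedAddCommGroup E] [NormedSpace ℝ E]
    {M : Type*} [TopologicalSpace M] {I : ModelWithCorners ℝ E M} {G : Type*}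
    [TopologicalSpace G] [ChartedSpace M G] [Group G] (g : LeftInvariantMetric I G) :
    E →ₗ[ℝ] E →ₗ[ℝ] ℝ :=
  LinearMap.mk₂ ℝ (fun v w => g.inner 1 v w)
    (fun v v' w => congrArg (fun l : TangentSpace I (1 : G) →L[ℝ] ℝ => l w)
      (map_add (g.inner 1) v v'))
    (fun c v w => congrArg (fun l : TangentSpace I (1 : G) →L[ℝ] ℝ => l w)
      (map_smul (g.inner 1) c v))
    (fun v w w' => map_add (g.inner 1 v) w w') (fun c v w => map_smul (g.inner 1 v) c w)

section FiberInf

variable {P H : Type*} [Group P] [Group H] (Ψ : P →* H) (N : P → ℝ≥0∞)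

/-- The infimum of a function over the fibers of a homomorphism. -/
def fiberInf (h : H) : ℝ≥0∞ := ⨅ p : {p // Ψ p = h}, N p

theorem fiberInf_apply_le (p : P) : fiberInf Ψ N (Ψ p) ≤ N p :=
  iInf_le (fun q : {q // Ψ q = Ψ p} => N q) ⟨p, rfl⟩

/-- Products of lifts are lifts of products. This makes the size of the best lift an admissible
function for `le_mul_dist_of_subadditive`. -/
theorem fiberInf_mul_le (hN : ∀ p q, N (p * q) ≤ N p + N q) (x y : H) :
    fiberInf Ψ N (x * y) ≤ fiberInf Ψ N x + fiberInf Ψ N y := by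
  simp only [fiberInf, ENNReal.iInf_add, ENNReal.add_iInf]
  refine le_iInf fun q => le_iInf fun p => (iInf_le _ ⟨p * q, ?_⟩).trans (hN _ _)
  rw [map_mul, p.2, q.2]

end FiberInf

namespace SU2

/-- The homomorphism `((a, t), y) ↦ φ (a, A t + B y)`. -/
def presentation {m k n : ℕ} {H : Type*} [Group H] (φ : SU2R n →* H)
    (A : EuclideanSpace ℝ (Fin m) →ₗ[ℝ] EuclideanSpace ℝ (Fin n))
    (B : EuclideanSpace ℝ (Fin k) →ₗ[ℝ] EuclideanSpace ℝ (Fin n)) : SU2R m × Rvec k →* H :=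
  φ.comp ((mapHom A).noncommCoprod (vecHom B) (commute_mapHom_vecHom A B))

theorem presentation_apply {m k n : ℕ} {H : Type*} [Group H] (φ : SU2R n →* H)
    (A : EuclideanSpace ℝ (Fin m) →ₗ[ℝ] EuclideanSpace ℝ (Fin n))
    (B : EuclideanSpace ℝ (Fin k) →ₗ[ℝ] EuclideanSpace ℝ (Fin n)) (p : SU2R m × Rvec k) :
    presentation φ A B p = φ (mapHom A p.1) * φ (vecHom B p.2) := by
  simp [presentation]

theorem presentation_mk {m k n : ℕ} {H : Type*} [Group H] (φ : SU2R n →* H)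
    (A : EuclideanSpace ℝ (Fin m) →ₗ[ℝ] EuclideanSpace ℝ (Fin n))
    (B : EuclideanSpace ℝ (Fin k) →ₗ[ℝ] EuclideanSpace ℝ (Fin n)) (u : SU2)
    (t : EuclideanSpace ℝ (Fin m)) (y : EuclideanSpace ℝ (Fin k)) :
    presentation φ A B ((u, Multiplicative.ofAdd t), Multiplicative.ofAdd y) =
      φ (u, Multiplicative.ofAdd (A t + B y)) := by
  rw [presentation_apply, ← map_mul]
  congr 1
  exact Prod.ext (mul_one u) rfl

theorem presentation_surjective {m k n : ℕ} {H : Type*} [Group H] {φ : SU2R n →* H}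
    (hφ : Function.Surjective φ) (A : EuclideanSpace ℝ (Fin m) →ₗ[ℝ] EuclideanSpace ℝ (Fin n))
    {B : EuclideanSpace ℝ (Fin k) →ₗ[ℝ] EuclideanSpace ℝ (Fin n)} (hB : Function.Surjective B) :
    Function.Surjective (presentation φ A B) := by
  intro h
  obtain ⟨⟨u, w⟩, rfl⟩ := hφ h
  obtain ⟨y, hy⟩ := hB (Multiplicative.toAdd w)
  refine ⟨((u, Multiplicative.ofAdd 0), Multiplicative.ofAdd y), ?_⟩
  rw [presentation_mk, map_zero, zero_add, hy, ofAdd_toAdd]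

theorem continuous_presentation {m k n : ℕ} {H : Type*} [Group H] [TopologicalSpace H]
    {φ : SU2R n →* H} (hφ : Continuous φ)
    (A : EuclideanSpace ℝ (Fin m) →ₗ[ℝ] EuclideanSpace ℝ (Fin n))
    (B : EuclideanSpace ℝ (Fin k) →ₗ[ℝ] EuclideanSpace ℝ (Fin n)) :
    Continuous (presentation φ A B) := by
  refine hφ.comp ?_
  have h : Continuous fun p : SU2R m × Rvec k => mapHom A p.1 * vecHom B p.2 :=
    ((contMDiff_mapHom A).continuous.comp continuous_fst).mul
      ((continuous_vecHom B).comp continuous_snd)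
  exact h

variable {n : ℕ} {E : Type*} [NormedAddCommGroup E] [NormedSpace ℝ E] [FiniteDimensional ℝ E]
  {M : Type*} [TopologicalSpace M] {I : ModelWithCorners ℝ E M} [I.Boundaryless]
  {H : Type*} [TopologicalSpace H] [ChartedSpace M H] [Group H] [LieGroup I ∞ H]

/-- Every element of a ball of `H` lifts to a ball of the product of `SU(2) × ℝ³`, with a decoupled
metric, and of a Euclidean space. -/
theorem exists_lift_of_mem_ball (g : LeftInvariantMetric I H) {φ : SU2R n →* H}
    {L : EuclideanSpace ℝ (Fin 3) × EuclideanSpace ℝ (Fin n) →L[ℝ] E}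
    (hφ : ContMDiff (modelSU2R n) I 1 φ) (hL : HasMFDerivAt (modelSU2R n) I φ 1 L)
    {e : OrthonormalBasis (Fin 3) ℝ (EuclideanSpace ℝ (Fin 3))}
    {T : EuclideanSpace ℝ (Fin 3) →ₗ[ℝ] EuclideanSpace ℝ (Fin n)}
    {B : EuclideanSpace ℝ (Fin n) →ₗ[ℝ] EuclideanSpace ℝ (Fin n)} {a : Fin 3 → ℝ} {d : ℝ}
    {X : E →ₗ[ℝ] EuclideanSpace ℝ (Fin 3)} {Y : E →ₗ[ℝ] EuclideanSpace ℝ (Fin n)}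
    (ha : ∀ i, 0 < a i) {A : EuclideanSpace ℝ (Fin 3) →ₗ[ℝ] EuclideanSpace ℝ (Fin n)}
    (hA : ∀ x, A (d • e.repr x) = T x)
    (hXY : ∀ w, L (tangentEquiv (X w), T (X w) + B (Y w)) = w)
    (hnorm : ∀ w, ∑ i, (a i * e.repr (X w) i) ^ 2 + ‖Y w‖ ^ 2 = g.form w w)
    {r : ℝ} (hr : 0 < r) {x : H} (hx : x ∈ g.ball 1 r) :
    ∃ p ∈ (decMetric e a ha d).ball 1 (3 * r) ×ˢ Rvec.ball n (3 * r),
      presentation φ A B p = x := by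
  let g' := decMetric e a ha d
  let he : ∀ i, ‖e i‖ = 1 := fun i => e.norm_eq_one i
  let Ψ := presentation φ A B
  let N : SU2R 3 × Rvec n → ℝ≥0∞ := fun p => max (g'.dist 1 p.1) ‖Multiplicative.toAdd p.2‖ₑ
  have hN : ∀ p q, N (p * q) ≤ N p + N q := fun p q =>
    max_le ((g'.dist_one_mul_le _ _).trans (add_le_add (le_max_left _ _) (le_max_left _ _)))
      ((enorm_add_le _ _).trans (add_le_add (le_max_right _ _) (le_max_right _ _)))
  have hN1 : N 1 = 0 := by simp [N, g'.dist_self]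
  have hinf1 : fiberInf Ψ N 1 = 0 := by
    have h := fiberInf_apply_le Ψ N 1
    rw [map_one, hN1] at h
    exact le_antisymm h zero_le
  obtain ⟨J, hJ⟩ := exists_euclidean_isometry g.form (fun v w => g.symm 1 v w)
    (fun v hv => g.pos 1 v hv)
  let W := EuclideanSpace ℝ (Fin (Module.finrank ℝ E))
  let X' : W →L[ℝ] EuclideanSpace ℝ (Fin 3) :=
    (LinearMap.toContinuousLinearMap X).comp (J : W →L[ℝ] E)
  let S' : W →L[ℝ] EuclideanSpace ℝ (Fin n) :=
    (LinearMap.toContinuousLinearMap (T.comp X + B.comp Y)).comp (J : W →L[ℝ] E)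
  let F : W → H := fun z => φ (productParam e he (e.repr (X' z)), Multiplicative.ofAdd (S' z))
  obtain ⟨hF, hdF⟩ := hasMFDerivAt_comp_productParam (I := I) hφ hL e X' S' (J := (J : W →L[ℝ] E))
    (fun z => hXY (J z))
  have hF1 : F 0 = 1 := by
    have h : ((productParam e he (e.repr (X' 0)), Multiplicative.ofAdd (S' 0)) : SU2R n) = 1 := by
      rw [map_zero, map_zero, map_zero, productParam_zero]
      rfl
    change φ _ = 1
    rw [h, map_one]
  have hNF : ∀ z, fiberInf Ψ N (F z) ≤ (2 : ℝ≥0) * ‖z‖ₑ := by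
    intro z
    let α := e.repr (X (J z))
    let y := Y (J z)
    -- The ℝ³ component d·α follows the velocities uᵢ + d fᵢ, and `A` sends it to T(X(Jz)), as
    -- required for a lift of F(z).
    let p : SU2R 3 × Rvec n :=
      ((productParam e he α, Multiplicative.ofAdd (d • α)), Multiplicative.ofAdd y)
    have hp : Ψ p = F z := by
      change presentation φ A B _ = _
      rw [presentation_mk, hA]
      rfl
    rw [← hp]
    refine (fiberInf_apply_le Ψ N p).trans ?_
    have hz : ∑ i, (a i * α i) ^ 2 + ‖y‖ ^ 2 = ‖z‖ ^ 2 := (hnorm (J z)).trans (hJ z)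
    have h2 : ((2 : ℝ≥0) : ℝ≥0∞) * ‖z‖ₑ = ENNReal.ofReal (2 * ‖z‖) := by
      rw [ENNReal.ofReal_mul zero_le_two, ofReal_norm]
      simp
    have hs : 0 ≤ ∑ i, (a i * α i) ^ 2 := Finset.sum_nonneg fun i _ => sq_nonneg _
    rw [h2]
    refine max_le ?_ ?_
    · refine (decMetric_dist_productParam_le e a ha d α).trans (ENNReal.ofReal_le_ofReal ?_)
      refine abs_le_of_sq_le_sq' ?_ (by positivity) |>.2
      have h4 : ∀ i, (a i * |α i|) ^ 2 = (a i * α i) ^ 2 := fun i => by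
        rw [mul_pow, sq_abs, mul_pow]
      -- Cauchy–Schwarz over three terms gives the factor √3, which is rounded up to 2.
      have h5 := sq_sum_le_card_mul_sum_sq (s := (Finset.univ : Finset (Fin 3)))
        (f := fun i => a i * |α i|)
      simp only [h4, Finset.card_univ, Fintype.card_fin, Nat.cast_ofNat] at h5
      nlinarith [sq_nonneg ‖y‖]
    · change ‖y‖ₑ ≤ _
      rw [← ofReal_norm]
      refine ENNReal.ofReal_le_ofReal (abs_le_of_sq_le_sq' ?_ (by positivity)).2
      nlinarith [sq_nonneg ‖z‖]
  -- Any K > 1 is allowed; 3/2 makes 2·K equal to 3. The strict inequality s < r keeps the lift in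
  -- an open ball.
  obtain ⟨s, hs, hle⟩ := g.le_mul_dist_of_subadditive hF hF1 J hdF
    (fun z => (congrArg Real.sqrt (hJ z)).trans (Real.sqrt_sq (norm_nonneg z)))
    (K := 3 / 2) (by rw [← NNReal.coe_lt_coe]; norm_num) (fiberInf_mul_le Ψ N hN) hinf1 hNF hx
  have h3 : fiberInf Ψ N x < ENNReal.ofReal (3 * r) := by
    refine hle.trans_lt ?_
    have h : ((2 : ℝ≥0) : ℝ≥0∞) * ((3 / 2 : ℝ≥0) : ℝ≥0∞) = 3 := by
      rw [← ENNReal.coe_mul, mul_div_cancel₀ _ two_ne_zero]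
      rfl
    rw [h, ENNReal.ofReal_mul (by norm_num), ENNReal.ofReal_ofNat]
    exact ENNReal.mul_lt_mul_right (by norm_num) (by norm_num) hs
  obtain ⟨⟨p, hp⟩, hlt⟩ := iInf_lt_iff.1 h3
  refine ⟨p, ⟨(le_max_left _ _).trans_lt hlt, ?_⟩, hp⟩
  have h4 := (le_max_right _ _).trans_lt hlt
  rw [← ofReal_norm] at h4
  exact (ENNReal.ofReal_lt_ofReal_iff (by positivity)).1 h4

end SU2
end

/-! ### Assembly of the theorem. -/

noncomputable section

open MeasureTheory Set Topology Filter

namespace SU2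

/-- A submersion of `SU(2) × ℝⁿ` transports the doubling property of the decoupled metrics to all
left-invariant metrics on the target. -/
theorem uniformlyDoubling_of_surjective {D : ℝ≥0}
    (hD : UniformlyDoubling {g : LeftInvariantMetric (modelSU2R 3) (SU2R 3) | IsDecoupled g} D)
    {n : ℕ} {E : Type*} [NormedAddCommGroup E] [NormedSpace ℝ E] [FiniteDimensional ℝ E]
    {M : Type*} [TopologicalSpace M] {I : ModelWithCorners ℝ E M} [I.Boundaryless]
    {H : Type*} [TopologicalSpace H] [T2Space H] [ChartedSpace M H] [Group H] [LieGroup I ∞ H]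
    (φ : SU2R n →* H) (hφ : ContMDiff (modelSU2R n) I ∞ φ) (hs : Function.Surjective φ)
    (hsub : Function.Surjective (mfderiv (modelSU2R n) I φ 1)) :
    UniformlyDoubling (univ : Set (LeftInvariantMetric I H)) ((2 ^ n * D) ^ 4) := by
  intro g _ μH hμH
  let _ : MeasurableSpace H := borel H
  have : BorelSpace H := ⟨rfl⟩
  let _ : MeasurableSpace (SU2R 3) := borel (SU2R 3)
  have : BorelSpace (SU2R 3) := ⟨rfl⟩
  let _ : MeasurableSpace (Rvec n) := borel (Rvec n)
  have : BorelSpace (Rvec n) := ⟨rfl⟩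
  have : IsTopologicalGroup H := topologicalGroup_of_lieGroup I ∞
  have : LocallyCompactSpace H := Manifold.locallyCompact_of_finiteDimensional I
  have hφ1 : ContMDiff (modelSU2R n) I 1 φ := hφ.of_le (by simp)
  let L : EuclideanSpace ℝ (Fin 3) × EuclideanSpace ℝ (Fin n) →L[ℝ] E :=
    mfderiv (modelSU2R n) I φ 1
  have hL : HasMFDerivAt (modelSU2R n) I φ 1 L := (hφ1.mdifferentiable one_ne_zero 1).hasMFDerivAt
  obtain ⟨e, T, B, a, d, X, Y, hcross, ha, hd, hB, h1, h2, h3, h4⟩ :=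
    exists_decoupled_presentation L.toLinearMap hsub g.form (fun v w => g.symm 1 v w)
      (fun v hv => g.pos 1 v hv)
  let A : EuclideanSpace ℝ (Fin 3) →ₗ[ℝ] EuclideanSpace ℝ (Fin n) :=
    d⁻¹ • T.comp (e.repr.symm.toLinearEquiv : _ →ₗ[ℝ] EuclideanSpace ℝ (Fin 3))
  have hAT : ∀ x, A (d • e.repr x) = T x := by
    intro x
    change d⁻¹ • T (e.repr.symm (d • e.repr x)) = T x
    rw [map_smul, map_smul, e.repr.symm_apply_apply, inv_smul_smul₀ hd.ne']
  let g' := decMetric e a ha d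
  let Ψ := presentation φ A B
  have hΨc : Continuous Ψ := continuous_presentation hφ.continuous A B
  have hΨs : Function.Surjective Ψ := presentation_surjective hs A hB
  -- The open mapping theorem for σ-compact groups gives second countability of H, which Weil's
  -- formula needs.
  have hΨo : IsOpenMap Ψ := Ψ.isOpenMap_of_sigmaCompact hΨs hΨc
  have : SecondCountableTopology H :=
    (hΨo.isQuotientMap hΨc hΨs).secondCountableTopology hΨo
  obtain ⟨ν, hν, hνball⟩ := Rvec.exists_haar n
  let μ₃ : Measure (SU2R 3) := Measure.haar
  have hfam := isBallFamily_decMetric e a ha d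
  have hμ₃ : ∀ r, 0 < r → μ₃ (g'.ball 1 (2 * r)) ≤ D * μ₃ (g'.ball 1 r) := by
    intro r hr
    have h := hD g' (isDecoupled_decMetric e a ha d hcross) μ₃ inferInstance
    -- The denominators in the supremum can be cleared because balls have positive finite measure.
    have h' : μ₃ (g'.ball 1 (2 * r)) / μ₃ (g'.ball 1 r) ≤ D := by
      refine le_trans ?_ h
      exact le_iSup_of_le (1 : SU2R 3) (le_iSup_of_le r (le_iSup_of_le hr le_rfl))
    have h0 : μ₃ (g'.ball 1 r) ≠ 0 :=
      ((hfam.isOpen r).measure_pos μ₃ ⟨1, hfam.one_mem r hr⟩).ne'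
    obtain ⟨K, hK, hsubK⟩ := hfam.subset_isCompact r
    have htop : μ₃ (g'.ball 1 r) ≠ ⊤ := ((measure_mono hsubK).trans_lt hK.measure_lt_top).ne
    exact (ENNReal.div_le_iff h0 htop).1 h'
  have hdouble : ∀ r, 0 < r → (μ₃.prod ν) (g'.ball 1 (2 * r) ×ˢ Rvec.ball n (2 * r)) ≤
      ((2 ^ n * D : ℝ≥0) : ℝ≥0∞) * (μ₃.prod ν) (g'.ball 1 r ×ˢ Rvec.ball n r) := by
    intro r hr
    rw [Measure.prod_prod, Measure.prod_prod, hνball r hr]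
    calc μ₃ (g'.ball 1 (2 * r)) * (2 ^ n * ν (Rvec.ball n r))
        ≤ (D * μ₃ (g'.ball 1 r)) * (2 ^ n * ν (Rvec.ball n r)) := mul_le_mul_left (hμ₃ r hr) _
      _ = _ := by push_cast; ring
  have hnorm : ∀ v : E, ∀ c : ℝ, g.form v v ≤ c → g.norm 1 v ≤ √c := fun v c hc =>
    Real.sqrt_le_sqrt hc
  -- Each factor of P maps without increasing distances, and the two distances add up to less than
  -- 2r.
  have himage : ∀ r, 0 < r → ∀ p ∈ g'.ball 1 r ×ˢ Rvec.ball n r, Ψ p ∈ g.ball 1 (2 * r) := by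
    rintro r hr p ⟨hp1, hp2⟩
    have hA := dist_comp_mapHom_le g hφ1 hL g' A (fun u t => by
      obtain ⟨x, rfl⟩ := tangentEquiv.surjective u
      rw [decMetric_norm_one]
      exact hnorm _ _ (h1 x t)) p.1
    have hv : g.dist 1 (φ (vecHom B p.2)) ≤ ENNReal.ofReal ‖Multiplicative.toAdd p.2‖ := by
      refine (dist_comp_vecHom_le g hφ1 hL B (Multiplicative.toAdd p.2)).trans
        (ENNReal.ofReal_le_ofReal ?_)
      have h := hnorm _ _ (h2 (Multiplicative.toAdd p.2))
      rwa [Real.sqrt_sq (norm_nonneg _)] at h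
    change g.dist 1 (Ψ p) < _
    have hΨp : Ψ p = φ (mapHom A p.1) * φ (vecHom B p.2) := presentation_apply φ A B p
    rw [hΨp, two_mul, ENNReal.ofReal_add hr.le hr.le]
    exact (g.dist_one_mul_le _ _).trans_lt (ENNReal.add_lt_add (hA.trans_lt hp1)
      (hv.trans_lt ((ENNReal.ofReal_lt_ofReal_iff hr).2 hp2)))
  have hlift : ∀ r, 0 < r → ∀ x ∈ g.ball 1 r,
      ∃ p ∈ g'.ball 1 (3 * r) ×ˢ Rvec.ball n (3 * r), Ψ p = x := fun r hr x hx =>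
    exists_lift_of_mem_ball g hφ1 hL ha hAT h3 h4 hr hx
  refine iSup_le fun x => iSup_le fun r => iSup_le fun hr => ?_
  rw [g.measure_ball μH x, g.measure_ball μH x]
  refine ENNReal.div_le_of_le_mul ?_
  have key := measure_le_of_quotient_ball (hfam.prod (Rvec.isBallFamily_ball n)) Ψ hΨc hΨs μH
    (μ₃.prod ν) hdouble himage hlift hr
  rw [ENNReal.coe_pow]
  exact key

end SU2
end

theorem mainTheorem4 (D : ℝ≥0)
    (hD : UniformlyDoubling {g : LeftInvariantMetric (modelSU2R 3) (SU2R 3) | IsDecoupled g} D)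
    (n : ℕ) :
    UniformlyDoubling (Set.univ : Set (LeftInvariantMetric (modelSU2R n) (SU2R n)))
      ((2 ^ n * D) ^ 4) ∧
    ∀ (S : Subgroup (SU2R n)) [S.Normal], IsClosed (S : Set (SU2R n)) →
      ∀ (E : Type*) [NormedAddCommGroup E] [NormedSpace ℝ E] [FiniteDimensional ℝ E]
        (H : Type*) [TopologicalSpace H] [T2Space H] [ChartedSpace E H] [Group H]
        [LieGroup 𝓘(ℝ, E) ∞ H] (φ : SU2R n →* H),
        IsLieQuotientMap (modelSU2R n) 𝓘(ℝ, E) S φ →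
        UniformlyDoubling (Set.univ : Set (LeftInvariantMetric 𝓘(ℝ, E) H))
          ((2 ^ n * D) ^ 4) := by
  constructor
  -- The group itself is its quotient by the trivial subgroup.
  · refine SU2.uniformlyDoubling_of_surjective hD (MonoidHom.id (SU2R n)) contMDiff_id
      Function.surjective_id ?_
    change Function.Surjective (mfderiv (modelSU2R n) (modelSU2R n) id 1)
    rw [mfderiv_id]
    exact Function.surjective_id
  · intro S _ _ E _ _ _ H _ _ _ _ _ φ hφ
    exact SU2.uniformlyDoubling_of_surjective hD φ hφ.contMDiff hφ.surjective (hφ.submersion 1)
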